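/- **Model.** Let $K,M,N_L,N_N\ge 1$ be integers and let $\sigma,\lambda_c,R_L,C_L,C_N,\alpha_L,q,\lambda,\sigma_n^2>0$, $\alpha_N>2$. A typical base station (BS) is at the origin of $\mathbb R^2$, and the $2K$ users of its cluster are i.i.d. with density $\frac1{2\pi\sigma^2}e^{-\|x\|^2/(2\sigma^2)}$. User $k$ (the near user), at $x_k$, is the user nearest to the origin. The other BSs form a homogeneous Poisson point process $\Phi$ of density $\lambda_c$. A link of length $r$ is in state $\kappa(r)=L$ if $r\le R_L$ and $\kappa(r)=N$ if $r>R_L$, and the path loss is $L_p(r)=C_{\kappa(r)}r^{-\alpha_{\kappa(r)}}$. The fading amplitude of a link in state $\kappa$ is Nakagami-$N_\kappa$, so that its square is Gamma distributed with shape $N_\kappa$ and rate $N_\kappa$. The effective channel gain from the typical BS to User $k$ is $M|g_k|^2$; from an interfering BS $y\in\Phi$ it is $M|g_{y\to k}|^2G_F(\vartheta_y)$, where $\vartheta_y$ is uniform on $[-\frac q\lambda,\frac q\lambda]$ and $G_F(x)=\frac{\sin^2(\pi Mx)}{M^2\sin^2(\pi x)}$ (extended by continuity) is the normalized Fejér kernel.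 The user positions, $\Phi$, and all fading amplitudes and angles $\vartheta_y$ are independent. With $I=\sum_{y\in\Phi}M|g_{y\to k}|^2G_F(\vartheta_y)L_p(\|x_k+y\|)$ and $S=M|g_k|^2L_p(\|x_k\|)$, put, for $a_k,a_j>0$, $$\gamma_{k\to j}=\frac{a_jS}{a_kS+I+\sigma_n^2},\qquad \gamma_k=\frac{a_kS}{I+\sigma_n^2}.$$ For thresholds $\tau_k,\tau_j>0$, the coverage probability of the near user (successful interference cancellation, and then successful decoding of its own signal) is $P_k(\tau_k)=\mathbb P[\gamma_{k\to j}>\tau_j,\ \gamma_k>\tau_k]$. **Analytical expression.** Let $f_d^1(r)=\frac{2Kr}{\sigma^2}e^{-Kr^2/\sigma^2}$ and $\psi_\kappa=N_\kappa(N_\kappa!)^{-1/N_\kappa}$. For a function $\mathcal L$ let $$\Theta_\kappa^{\mathcal L}(r,\tau,\beta)=\sum_{n=1}^{N_\kappa}(-1)^{n+1}\binom{N_\kappa}{n}\exp\!\Big(-\frac{n\psi_\kappa\tau r^{\alpha_\kappa}\sigma_n^2}{\beta MC_\kappa}\Big)\,\mathcal L\Big(\frac{n\psi_\kappa\tau r^{\alpha_\kappa}}{\beta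 MC_\kappa}\Big),$$ $$T(\mathcal L)=\int_0^{R_L}\Theta_L^{\mathcal L}(r,\tau_k,a_k)f_d^1(r)\,dr+\int_{R_L}^\infty\Theta_N^{\mathcal L}(r,\tau_k,a_k)f_d^1(r)\,dr.$$ Let $\mathcal L_I(s)=\mathbb E[e^{-sI}]$ be the Laplace transform of the interference and, for $m\ge1$, with $\zeta_i=\cos\big(\frac{2i-1}{2m}\pi\big)$, let $$\mathcal L_I^{(m)}(s)=\exp\Big(-\frac{\pi^2\lambda_cR_L^2}{2m}\sum_{i=1}^{m}\mathcal G\Big(s,\frac{\zeta_iq}{\lambda}\Big)\sqrt{1-\zeta_i^2}\Big)$$ be its Gauss–Chebyshev closed form, where $$\mathcal G(s,x)=\rho_N\Big(\frac{sMC_NG_F(x)}{N_NR_L^{\alpha_N}}\Big)-\rho_L\Big(\frac{N_LR_L^{\alpha_L}}{sMG_F(x)C_L}\Big),\qquad \mathcal G(s,x)=0\ \text{ if } sG_F(x)=0,$$ $$\rho_L(v)=\frac{2v^{N_L}}{\alpha_LN_L+2}\,{}_2F_1\Big(N_L,N_L+\tfrac2{\alpha_L};N_L+\tfrac2{\alpha_L}+1;-v\Big),\qquad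 \rho_N(v)={}_2F_1\Big(-\tfrac2{\alpha_N},N_N;1-\tfrac2{\alpha_N};-v\Big).$$ **Theorem 1.** Suppose $a_j>a_k\tau_j(1+1/\tau_k)$. Then the integrals in $T(\mathcal L_I)$ and in $T(\mathcal L_I^{(m)})$, $m\ge1$, converge absolutely, and $P_k(\tau_k)\approx T(\mathcal L_I)=\lim_{m\to\infty}T(\mathcal L_I^{(m)})$ in the following sense. The approximation is an upper bound, and its error is at most that of the approximation $(1-e^{-\psi_\kappa x})^{N_\kappa}$ of the distribution function $F_\kappa$ of the Gamma law with shape and rate $N_\kappa$: $$0\le T(\mathcal L_I)-P_k(\tau_k)\le\max_{\kappa\in\{L,N\}}\ \sup_{x\ge0}\Big(F_\kappa(x)-(1-e^{-\psi_\kappa x})^{N_\kappa}\Big).$$ -/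

import Mathlib

open MeasureTheory ProbabilityTheory Filter Topology Set
open scoped ENNReal NNReal

namespace MmWaveNOMA

/-- The Euclidean plane. -/
abbrev Plane : Type := EuclideanSpace ℝ (Fin 2)

/-- The state of a link: line of sight or not. -/
inductive Link : Type
  | los
  | nlos

/-- The deterministic parameters of the network. -/
structure Params where
  /-- half the number of users in a cluster -/
  K : ℕ
  /-- standard deviation (per coordinate) of the user positions -/
  sigma : ℝ
  /-- density of the base stations -/
  density : ℝ
  /-- radius of the line-of-sight disc -/
  RL : ℝ
  /-- intercepts of the path loss law -/
  C : Link → ℝ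
  /-- path loss exponents -/
  expo : Link → ℝ
  /-- Nakagami fading parameters -/
  N : Link → ℕ
  /-- number of antenna elements -/
  M : ℕ
  /-- antenna spacing -/
  spacing : ℝ
  /-- carrier wavelength -/
  wavelength : ℝ
  /-- noise power normalized by the transmit power -/
  noise : ℝ
  K_pos : 0 < K
  sigma_pos : 0 < sigma
  density_pos : 0 < density
  RL_pos : 0 < RL
  C_pos : ∀ κ, 0 < C κ
  expo_los_pos : 0 < expo Link.los
  two_lt_expo_nlos : 2 < expo Link.nlos
  N_pos : ∀ κ, 0 < N κ
  M_pos : 0 < M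
  spacing_pos : 0 < spacing
  wavelength_pos : 0 < wavelength
  noise_pos : 0 < noise

/-! ### Poisson point processes and the laws of the model -/

/-- The number of points of the enumerated point process `Y` in `B`. -/
noncomputable def pointCount {Ω E : Type*} [MeasurableSpace E] (Y : ℕ → Ω → E) (B : Set E)
    (ω : Ω) : ℝ≥0∞ :=
  Measure.sum (fun n => Measure.dirac (Y n ω)) B

/-- `Y` enumerates the points of a Poisson point process with intensity measure `ν`: the number of
points in a set of finite intensity is Poisson distributed, and the numbers of points in disjoint
sets are independent. -/
structure IsPoissonProcess {Ω E : Type*} [MeasurableSpace Ω] [MeasurableSpace E]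
    (Y : ℕ → Ω → E) (ν : Measure E) (μ : Measure Ω) : Prop where
  measurable : ∀ n, Measurable (Y n)
  hasLaw_count : ∀ B, MeasurableSet B → ν B ≠ ∞ →
    HasLaw (pointCount Y B) ((poissonMeasure (ν B).toNNReal).map (Nat.cast : ℕ → ℝ≥0∞)) μ
  indep_count : ∀ (m : ℕ) (B : Fin m → Set E), (∀ i, MeasurableSet (B i)) →
    Pairwise (fun i j => Disjoint (B i) (B j)) → iIndepFun (fun i => pointCount Y (B i)) μ

/-- The law of the amplitude of normalized Nakagami fading with parameter `N`: the square of the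
amplitude is Gamma distributed with shape `N` and rate `N`, so has mean `1`. -/
noncomputable def nakagamiMeasure (N : ℕ) : Measure ℝ :=
  (gammaMeasure N N).map Real.sqrt

/-- The law of a user position relative to its base station: the centred isotropic normal law on
the plane, with density `exp (-‖x‖² / (2 σ²)) / (2 π σ²)`. -/
noncomputable def userLaw (sigma : ℝ) : Measure Plane :=
  volume.withDensity fun x =>
    ENNReal.ofReal (1 / (2 * Real.pi * sigma ^ 2) * Real.exp (-‖x‖ ^ 2 / (2 * sigma ^ 2)))

/-- The law of the difference of two beam directions: uniform on `[-q / λ, q / λ]`, for antenna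
spacing `q` and wavelength `λ`. -/
noncomputable def angleLaw (p : Params) : Measure ℝ :=
  volume[|Set.Icc (-(p.spacing / p.wavelength)) (p.spacing / p.wavelength)]

/-! ### Path loss, beamforming, interference and SINR -/

/-- The state of a link of length `r` in the disc model of blockage. -/
noncomputable def Params.link (p : Params) (r : ℝ) : Link :=
  if r ≤ p.RL then Link.los else Link.nlos

/-- The path loss law. -/
noncomputable def Params.pathLoss (p : Params) (r : ℝ) : ℝ :=
  p.C (p.link r) * r ^ (-p.expo (p.link r))

/-- The normalized Fejér kernel `sin² (π M x) / (M² sin² (π x))`, extended by continuity to the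
integers. -/
noncomputable def fejer (M : ℕ) (x : ℝ) : ℝ :=
  if Real.sin (Real.pi * x) = 0 then 1
  else Real.sin (Real.pi * M * x) ^ 2 / ((M : ℝ) ^ 2 * Real.sin (Real.pi * x) ^ 2)

/-- The random elements of the network seen from the typical cluster, whose base station is at the
origin: `user i` are the positions of the users of the typical cluster, `near` is the (random)
label of the near user, `g κ` is the fading amplitude of the channel from the typical base station
to the near user if this link is in state `κ`, `Y n` are the interfering base stations, `G n κ` is
the fading amplitude of the channel from the `n`-th of them to the near user if this link is in
state `κ`, and `ϑ n` is the difference of the beam directions in its effective channel gain. -/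
structure IsNetwork (p : Params) {Ω : Type*} [MeasurableSpace Ω] (μ : Measure Ω)
    (user : Fin (2 * p.K) → Ω → Plane) (near : Ω → Fin (2 * p.K)) (g : Link → Ω → ℝ)
    (Y : ℕ → Ω → Plane) (G : ℕ → Link → Ω → ℝ) (ϑ : ℕ → Ω → ℝ) : Prop where
  measurable_user : ∀ i, Measurable (user i)
  hasLaw_user : ∀ i, HasLaw (user i) (userLaw p.sigma) μ
  indep_user : iIndepFun user μ
  measurable_near : Measurable near
  near_nearest : ∀ ω i, ‖user (near ω) ω‖ ≤ ‖user i ω‖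
  measurable_g : ∀ κ, Measurable (g κ)
  hasLaw_g : ∀ κ, HasLaw (g κ) (nakagamiMeasure (p.N κ)) μ
  poisson_Y : IsPoissonProcess Y (ENNReal.ofReal p.density • volume) μ
  measurable_G : ∀ n κ, Measurable (G n κ)
  hasLaw_G : ∀ n κ, HasLaw (G n κ) (nakagamiMeasure (p.N κ)) μ
  measurable_ϑ : ∀ n, Measurable (ϑ n)
  hasLaw_ϑ : ∀ n, HasLaw (ϑ n) (angleLaw p) μ
  /- The fading and the direction of one interferer are independent. -/
  indep_G_ϑ : ∀ n, IndepFun (fun ω κ => G n κ ω) (ϑ n) μ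
  /- The marks of different interferers are independent. -/
  indep_marks : iIndepFun (fun n ω => ((fun κ => G n κ ω : Link → ℝ), ϑ n ω)) μ
  /- Users, near-user fading, interferer positions and interferer marks are independent. -/
  indep_users_rest : IndepFun (fun ω i => user i ω)
    (fun ω => ((fun κ => g κ ω : Link → ℝ), (fun n => Y n ω : ℕ → Plane),
      (fun n => ((fun κ => G n κ ω), ϑ n ω) : ℕ → (Link → ℝ) × ℝ))) μ
  indep_g_rest : IndepFun (fun ω κ => g κ ω)
    (fun ω => ((fun n => Y n ω : ℕ → Plane),
      (fun n => ((fun κ => G n κ ω), ϑ n ω) : ℕ → (Link → ℝ) × ℝ))) μ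
  indep_Y_marks : IndepFun (fun ω n => Y n ω)
    (fun ω => (fun n => ((fun κ => G n κ ω), ϑ n ω) : ℕ → (Link → ℝ) × ℝ)) μ

section RandomQuantities

variable (p : Params) {Ω : Type*} (user : Fin (2 * p.K) → Ω → Plane) (near : Ω → Fin (2 * p.K))
  (g : Link → Ω → ℝ) (Y : ℕ → Ω → Plane) (G : ℕ → Link → Ω → ℝ) (ϑ : ℕ → Ω → ℝ)

/-- The inter-cluster interference at the near user, normalized by the transmit power. -/
noncomputable def interference (ω : Ω) : ℝ≥0∞ :=
  ∑' n, ENNReal.ofReal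
    (p.M * G n (p.link ‖user (near ω) ω + Y n ω‖) ω ^ 2 * fejer p.M (ϑ n ω) *
      p.pathLoss ‖user (near ω) ω + Y n ω‖)

/-- Effective channel gain times path loss, from the typical base station to the near user. -/
noncomputable def signalPower (ω : Ω) : ℝ :=
  p.M * g (p.link ‖user (near ω) ω‖) ω ^ 2 * p.pathLoss ‖user (near ω) ω‖

/-- SINR of the near user when it decodes the signal of the far user. -/
noncomputable def sinrSIC (aj ak : ℝ) (ω : Ω) : ℝ≥0∞ :=
  ENNReal.ofReal (aj * signalPower p user near g ω) /
    (ENNReal.ofReal (ak * signalPower p user near g ω) + interference p user near Y G ϑ ω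
      + ENNReal.ofReal p.noise)

/-- SINR of the near user when it decodes its own signal, after interference cancellation. -/
noncomputable def sinrNear (ak : ℝ) (ω : Ω) : ℝ≥0∞ :=
  ENNReal.ofReal (ak * signalPower p user near g ω) /
    (interference p user near Y G ϑ ω + ENNReal.ofReal p.noise)

/-- Coverage probability of the near user: the near user cancels the signal of the far user
successfully, and its own SINR exceeds the threshold. -/
noncomputable def coverageNear [MeasurableSpace Ω] (μ : Measure Ω) (aj ak τj τk : ℝ) : ℝ :=
  μ.real {ω | ENNReal.ofReal τj < sinrSIC p user near g Y G ϑ aj ak ω ∧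
    ENNReal.ofReal τk < sinrNear p user near g Y G ϑ ak ω}

/-- The Laplace transform of the interference (which is almost surely finite). -/
noncomputable def laplaceInterference [MeasurableSpace Ω] (μ : Measure Ω) (s : ℝ) : ℝ :=
  ∫ ω, Real.exp (-(s * (interference p user near Y G ϑ ω).toReal)) ∂μ

end RandomQuantities

/-! ### The closed form of the Laplace transform, with Gauss-Chebyshev quadrature -/

/-- The Gauss hypergeometric function at real `z ≤ 0` (analytically continued from the unit disc):
by the Pfaff transformation, `F(a, b; c; z) = (1 - z)⁻ᵃ F(a, c - b; c; z / (z - 1))`, where now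
`z / (z - 1) ∈ [0, 1)` is in the disc of convergence of the hypergeometric series. -/
noncomputable def gaussHypergeometric (a b c z : ℝ) : ℝ :=
  (1 - z) ^ (-a) * ordinaryHypergeometric a (c - b) c (z / (z - 1))

noncomputable def rhoL (p : Params) (v : ℝ) : ℝ :=
  gaussHypergeometric (p.N Link.los) (p.N Link.los + 2 / p.expo Link.los)
      (p.N Link.los + 2 / p.expo Link.los + 1) (-v) * (2 * v ^ p.N Link.los) /
    (p.expo Link.los * p.N Link.los + 2)

noncomputable def rhoN (p : Params) (v : ℝ) : ℝ :=
  gaussHypergeometric (-(2 / p.expo Link.nlos)) (p.N Link.nlos) (1 - 2 / p.expo Link.nlos) (-v)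

/-- The function `G_F^I(s, x)`. At a zero of the Fejér kernel the argument of `rhoL` is infinite,
and the value is the limit `ρ_N(0) - ρ_L(∞) = 1 - 1 = 0`. -/
noncomputable def quadIntegrand (p : Params) (s x : ℝ) : ℝ :=
  if s * fejer p.M x = 0 then 0
  else
    rhoN p (s * p.M * p.C Link.nlos * fejer p.M x /
        (p.N Link.nlos * p.RL ^ p.expo Link.nlos)) -
      rhoL p (p.N Link.los * p.RL ^ p.expo Link.los /
        (s * p.M * fejer p.M x * p.C Link.los))

/-- The `i`-th of the `n` Gauss-Chebyshev nodes. -/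
noncomputable def chebNode (n i : ℕ) : ℝ := Real.cos ((2 * i - 1) / (2 * n) * Real.pi)

/-- The closed form of the Laplace transform of the interference, with `n` quadrature nodes. -/
noncomputable def laplaceClosed (p : Params) (n : ℕ) (s : ℝ) : ℝ :=
  Real.exp (-(Real.pi ^ 2 * p.density * p.RL ^ 2 / (2 * n) *
    ∑ i ∈ Finset.Icc 1 n, quadIntegrand p s (chebNode n i * p.spacing / p.wavelength) *
      Real.sqrt (1 - chebNode n i ^ 2)))

/-! ### The analytical expression of the coverage probability -/

/-- The density of the distance of the nearest user. -/
noncomputable def nearestDensity (p : Params) (r : ℝ) : ℝ :=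
  2 * p.K * r / p.sigma ^ 2 * Real.exp (-(p.K * r ^ 2 / p.sigma ^ 2))

/-- `ψ = N (N!) ^ (-1 / N)`. -/
noncomputable def psi (N : ℕ) : ℝ := N * (N.factorial : ℝ) ^ (-(1 / (N : ℝ)))

/-- The function `Θ_κ(r, τ, β)`, for a Laplace transform `lap` of the interference. -/
noncomputable def Theta (p : Params) (lap : ℝ → ℝ) (κ : Link) (r τ β : ℝ) : ℝ :=
  ∑ n ∈ Finset.Icc 1 (p.N κ), (-1) ^ (n + 1) * ((p.N κ).choose n : ℝ) *
    Real.exp (-(n * psi (p.N κ) * τ * r ^ p.expo κ * p.noise / (β * p.M * p.C κ))) *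
    lap (n * psi (p.N κ) * τ * r ^ p.expo κ / (β * p.M * p.C κ))

/-- The analytical approximation of the coverage probability of the near user. -/
noncomputable def coverageFormula (p : Params) (lap : ℝ → ℝ) (τk ak : ℝ) : ℝ :=
  (∫ r in Set.Icc 0 p.RL, Theta p lap Link.los r τk ak * nearestDensity p r) +
    ∫ r in Set.Ici p.RL, Theta p lap Link.nlos r τk ak * nearestDensity p r

/-- Both integrals in the analytical approximation converge absolutely. -/
def FormulaIntegrable (p : Params) (lap : ℝ → ℝ) (τk ak : ℝ) : Prop :=
  IntegrableOn (fun r => Theta p lap Link.los r τk ak * nearestDensity p r) (Set.Icc 0 p.RL) ∧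
    IntegrableOn (fun r => Theta p lap Link.nlos r τk ak * nearestDensity p r) (Set.Ici p.RL)

/-- The error of the approximation of the distribution function of the normalized Gamma law with
parameter `N` by `(1 - exp (-ψ x)) ^ N`. -/
noncomputable def gammaError (N : ℕ) (x : ℝ) : ℝ :=
  cdf (gammaMeasure N N) x - (1 - Real.exp (-(psi N * x))) ^ N

end MmWaveNOMA

/-!
Let `X` be the level that the squared fading amplitude `g²` of the near user has to exceed for its
own SINR to exceed the threshold (`fadingThreshold`); it depends on the position of the near user
and on the interference. The condition on `aj` makes successful interference cancellation a
consequence of successful decoding (`sic_of_near`), so that coverage is the event `X < g²`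
(`coverage_iff`). As `g²` has a Gamma law with distribution function `F` and is independent of `X`,
the coverage probability is the mean of `1 - F(X)` (`coverageNear_eq_integral`).

The analytical expression is the mean of `1 - (1 - exp (-ψ X)) ^ N`
(`coverageFormula_eq_integral_threshold`). To see this, expand the power by the binomial theorem:
`X` is affine in the interference, so each term is a Laplace transform of the interference,
conditional on the position of the near user. This position does not matter, because the Poisson
process is stationary (`lintegral_negExp_interferenceAt`), and `nearestDensity` is the density of
the distance of the near user (`map_norm_near_user`). So the error of the
analytical expression is the mean of `gammaError` at `X`. It is at most any bound of `gammaError`, and it is nonnegative by Alzer's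
inequality (`gammaError_nonneg`): the derivative of `gammaError` changes sign at most once, from
positive to negative, while `gammaError` vanishes at `0` and at infinity.

For the closed form, the Laplace functional of the Poisson process
(`lintegral_negExp_poissonProcess`) gives the Laplace transform of the interference as the
exponential of an integral over the plane and over the beam direction. In polar coordinates the
plane integral is explicit (`integral_radial`), because `ρ_L` and `ρ_N` solve first-order linear
differential equations, which are recursions for the coefficients of their hypergeometric series.
The integral over the beam direction is approximated by Gauss-Chebyshev quadrature, which is the
midpoint rule after the substitution `x = cos θ` (`tendsto_laplaceClosed`). All Laplace transforms
are bounded by `1`, so that the analytical expressions converge by dominated convergence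
(`tendsto_coverageFormula`).
-/

namespace MmWaveNOMA

/-! ### Alzer's inequality for the incomplete Gamma function -/

/-- If the derivative of `f`, once positive, stays positive, and `f 0 = 0`, then `f`, once positive,
increases ever after. -/
theorem le_of_pos_of_deriv_single_crossing {f f' : ℝ → ℝ} (h0 : f 0 = 0)
    (hc : ContinuousOn f (Ici 0)) (hf : ∀ x, 0 < x → HasDerivAt f (f' x) x)
    (hs : ∀ c, 0 < c → 0 < f' c → ∀ y, c ≤ y → 0 < f' y) {c : ℝ} (hc0 : 0 < c) (hfc : 0 < f c)
    {y : ℝ} (hy : c ≤ y) : f c ≤ f y := by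
  obtain ⟨d, hd, hd'⟩ := exists_hasDerivAt_eq_slope f f' hc0
    (hc.mono Icc_subset_Ici_self) (fun x hx => hf x hx.1)
  have hd1 : 0 < f' d := by
    rw [hd', h0]
    exact div_pos (by simpa using hfc) (by simpa using hc0)
  have hmono : MonotoneOn f (Ici d) := by
    refine monotoneOn_of_deriv_nonneg (convex_Ici d) (hc.mono (Ici_subset_Ici.2 hd.1.le)) ?_ ?_
    · intro x hx
      rw [interior_Ici] at hx
      exact (hf x (hd.1.trans hx)).differentiableAt.differentiableWithinAt
    · intro x hx
      rw [interior_Ici] at hx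
      rw [(hf x (hd.1.trans hx)).deriv]
      exact (hs d hd.1 hd1 x (le_of_lt hx)).le
  exact hmono hd.2.le (hd.2.le.trans hy) hy

/-- The single-crossing property passes from the derivative to a function that vanishes at `0`. -/
theorem pos_of_pos_of_deriv_single_crossing {f f' : ℝ → ℝ} (h0 : f 0 = 0)
    (hf : ∀ x, HasDerivAt f (f' x) x)
    (hs : ∀ c, 0 < c → 0 < f' c → ∀ y, c ≤ y → 0 < f' y) {c : ℝ} (hc0 : 0 < c) (hfc : 0 < f c)
    {y : ℝ} (hy : c ≤ y) : 0 < f y :=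
  hfc.trans_le (le_of_pos_of_deriv_single_crossing h0
    (fun x _ => (hf x).continuousAt.continuousWithinAt) (fun x _ => hf x) hs hc0 hfc hy)

/-- The comparison of `y * exp (-k y)` with `1 - exp (-y)` changes sign at most once. -/
theorem exp_single_crossing (k : ℝ) {c : ℝ} (hc : 0 < c)
    (h : c * Real.exp (-(k * c)) < 1 - Real.exp (-c)) {y : ℝ} (hy : c ≤ y) :
    y * Real.exp (-(k * y)) < 1 - Real.exp (-y) := by
  have key : ∀ z : ℝ, z * Real.exp (-(k * z)) < 1 - Real.exp (-z) ↔
      0 < Real.exp (k * z) - Real.exp ((k - 1) * z) - z := by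
    intro z
    have e1 : Real.exp ((k - 1) * z) = Real.exp (k * z) * Real.exp (-z) := by
      rw [← Real.exp_add]; ring_nf
    have e2 : z = Real.exp (k * z) * (z * Real.exp (-(k * z))) := by
      rw [mul_left_comm, ← Real.exp_add]; simp
    have e3 : Real.exp (k * z) - Real.exp ((k - 1) * z) - z =
        Real.exp (k * z) * (1 - Real.exp (-z) - z * Real.exp (-(k * z))) := by
      rw [e1, mul_sub, mul_sub, ← e2]; ring
    rw [e3, mul_pos_iff_of_pos_left (Real.exp_pos _), sub_pos]
  rw [key] at h ⊢
  -- The single-crossing property passes from the second derivative to the first, and on to the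
  -- function itself; the second derivative is a monotone function times an exponential.
  have hd : ∀ b x : ℝ, HasDerivAt (fun x => Real.exp (b * x)) (b * Real.exp (b * x)) x := by
    intro b x
    have := ((hasDerivAt_id x).const_mul b).exp
    simpa [mul_comm] using this
  refine pos_of_pos_of_deriv_single_crossing
    (f := fun z => Real.exp (k * z) - Real.exp ((k - 1) * z) - z)
    (f' := fun z => k * Real.exp (k * z) - (k - 1) * Real.exp ((k - 1) * z) - 1) (by simp)
    (fun x => ((hd k x).sub (hd (k - 1) x)).sub (hasDerivAt_id x)) ?_ hc h hy
  intro c hc h y hy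
  refine pos_of_pos_of_deriv_single_crossing
    (f := fun z => k * Real.exp (k * z) - (k - 1) * Real.exp ((k - 1) * z) - 1)
    (f' := fun z => k * (k * Real.exp (k * z)) - (k - 1) * ((k - 1) * Real.exp ((k - 1) * z)))
    (by simp)
    (fun x => by simpa using
      (((hd k x).const_mul k).sub ((hd (k - 1) x).const_mul (k - 1))).sub_const 1) ?_ hc h hy
  intro c hc h y hy
  have e : ∀ z : ℝ, k * (k * Real.exp (k * z)) - (k - 1) * ((k - 1) * Real.exp ((k - 1) * z)) =
      Real.exp ((k - 1) * z) * (k ^ 2 * Real.exp z - (k - 1) ^ 2) := by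
    intro z
    have : Real.exp (k * z) = Real.exp ((k - 1) * z) * Real.exp z := by
      rw [← Real.exp_add]; ring_nf
    rw [this]; ring
  rw [e, mul_pos_iff_of_pos_left (Real.exp_pos _)] at h ⊢
  have : Real.exp c ≤ Real.exp y := Real.exp_le_exp.2 hy
  nlinarith [mul_le_mul_of_nonneg_left this (sq_nonneg k)]

theorem psi_pos {N : ℕ} (hN : 0 < N) : 0 < psi N := by
  unfold psi; positivity

theorem psi_pow {N : ℕ} (hN : 0 < N) : psi N ^ N * N.factorial = (N : ℝ) ^ N := by
  have h : (0 : ℝ) < N.factorial := by positivity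
  have hN' : (N : ℝ) ≠ 0 := by positivity
  rw [psi, mul_pow, ← Real.rpow_natCast (_ ^ _), ← Real.rpow_mul h.le, mul_assoc]
  rw [show -(1 / (N : ℝ)) * N = -1 by field_simp, Real.rpow_neg_one, inv_mul_cancel₀ h.ne', mul_one]

theorem cdf_gammaMeasure_natCast {N : ℕ} (hN : 0 < N) {x : ℝ} (hx : 0 ≤ x) :
    cdf (gammaMeasure N N) x =
      ∫ t in (0)..x, (N : ℝ) ^ N / Real.Gamma N * (t ^ (N - 1) * Real.exp (-(N * t))) := by
  have hN' : (0 : ℝ) < N := by positivity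
  rw [cdf_gammaMeasure_eq_integral hN' hN', intervalIntegral.integral_of_le hx,
    ← integral_Icc_eq_integral_Ioc]
  have h1 : ∫ t in Iic x, gammaPDFReal N N t = ∫ t in Icc 0 x, gammaPDFReal N N t := by
    refine setIntegral_eq_of_subset_of_forall_sdiff_eq_zero measurableSet_Iic Icc_subset_Iic_self ?_
    intro t ht
    have : t < 0 := by
      by_contra h
      exact ht.2 ⟨not_lt.1 h, ht.1⟩
    simp [gammaPDFReal, not_le.2 this]
  rw [h1]
  refine setIntegral_congr_fun measurableSet_Icc fun t ht => ?_
  have : (t : ℝ) ^ ((N : ℝ) - 1) = t ^ (N - 1) := by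
    rw [← Real.rpow_natCast, Nat.cast_sub hN]; simp
  simp only [gammaPDFReal, if_pos ht.1, this, Real.rpow_natCast]
  ring

theorem continuous_gammaError {N : ℕ} (hN : 0 < N) : ContinuousOn (gammaError N) (Ici 0) := by
  have : ContinuousOn (fun x => (∫ t in (0)..x, (N : ℝ) ^ N / Real.Gamma N *
      (t ^ (N - 1) * Real.exp (-(N * t)))) - (1 - Real.exp (-(psi N * x))) ^ N) (Ici 0) := by
    refine Continuous.continuousOn ?_
    refine Continuous.sub ?_ (by fun_prop)
    exact intervalIntegral.continuous_primitive
      (fun a b => (Continuous.intervalIntegrable (by fun_prop) a b)) 0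
  refine this.congr fun x hx => ?_
  rw [gammaError, cdf_gammaMeasure_natCast hN hx]

theorem hasDerivAt_gammaError {N : ℕ} (hN : 0 < N) {x : ℝ} (hx : 0 < x) :
    HasDerivAt (gammaError N) (N * psi N * Real.exp (-(psi N * x)) *
      ((psi N * x) ^ (N - 1) * Real.exp (-((N - psi N) * x)) -
        (1 - Real.exp (-(psi N * x))) ^ (N - 1))) x := by
  have h1 : HasDerivAt (fun x => ∫ t in (0)..x, (N : ℝ) ^ N / Real.Gamma N *
      (t ^ (N - 1) * Real.exp (-(N * t))))
      ((N : ℝ) ^ N / Real.Gamma N * (x ^ (N - 1) * Real.exp (-(N * x)))) x := by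
    refine intervalIntegral.integral_hasDerivAt_right
      (Continuous.intervalIntegrable (by fun_prop) _ _) ?_ (Continuous.continuousAt (by fun_prop))
    exact (Continuous.stronglyMeasurable (by fun_prop)).stronglyMeasurableAtFilter
  have h2 : HasDerivAt (fun x => (1 - Real.exp (-(psi N * x))) ^ N)
      (N * (1 - Real.exp (-(psi N * x))) ^ (N - 1) * (psi N * Real.exp (-(psi N * x)))) x := by
    have := (((((hasDerivAt_id x).const_mul (psi N)).neg).exp).const_sub 1).pow N
    refine this.congr_deriv ?_
    simp only [Pi.neg_apply, id_eq, mul_one]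
    ring
  have h3 := h1.sub h2
  have hG : (N : ℝ) ^ N / Real.Gamma N = N * psi N * psi N ^ (N - 1) := by
    obtain ⟨m, rfl⟩ : ∃ m, N = m + 1 := ⟨N - 1, by omega⟩
    have h := psi_pow hN
    rw [Nat.cast_succ, Real.Gamma_nat_eq_factorial, ← Nat.cast_succ, div_eq_iff (by positivity),
      ← h, Nat.factorial_succ]
    push_cast
    ring
  have he : Real.exp (-(N * x)) = Real.exp (-(psi N * x)) * Real.exp (-((N - psi N) * x)) := by
    rw [← Real.exp_add]; ring_nf
  refine (h3.congr_of_eventuallyEq ?_).congr_deriv ?_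
  · filter_upwards [lt_mem_nhds hx] with y hy
    rw [gammaError, cdf_gammaMeasure_natCast hN hy.le]
    rfl
  · rw [hG, he, mul_pow]; ring

/-- **Alzer's inequality** for integer shape: `(1 - exp (-ψ x)) ^ N` is a lower bound for the
distribution function of the normalized Gamma law. The derivative of the difference changes sign
at most once, from positive to negative, and the difference vanishes at `0` and at infinity. -/
theorem gammaError_nonneg {N : ℕ} (hN : 0 < N) {x : ℝ} (hx : 0 ≤ x) : 0 ≤ gammaError N x := by
  have h0 : gammaError N 0 = 0 := by
    rw [gammaError, cdf_gammaMeasure_natCast hN le_rfl]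
    simp [hN.ne']
  rcases hx.eq_or_lt with rfl | hx
  · exact h0.ge
  by_contra! hneg
  have hψ := psi_pos hN
  have hlim : Tendsto (gammaError N) atTop (𝓝 0) := by
    have h1 : Tendsto (fun x => (1 - Real.exp (-(psi N * x))) ^ N) atTop (𝓝 1) := by
      have : Tendsto (fun x => Real.exp (-(psi N * x))) atTop (𝓝 0) :=
        Real.tendsto_exp_neg_atTop_nhds_zero.comp (tendsto_id.const_mul_atTop hψ)
      simpa using (this.const_sub 1).pow N
    have := (tendsto_cdf_atTop (gammaMeasure N N)).sub h1
    rw [sub_self] at this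
    exact this
  -- Once negative, the error keeps decreasing, which contradicts its limit `0`.
  have hmono : ∀ y, x ≤ y → gammaError N y ≤ gammaError N x := by
    intro y hy
    have := le_of_pos_of_deriv_single_crossing (f := fun x => -gammaError N x) (by simp [h0])
      (continuous_gammaError hN).neg (fun x hx => (hasDerivAt_gammaError hN hx).neg) ?_ hx
      (by simpa using hneg) hy
    · simpa using this
    intro c hc h y hy
    have hsign : ∀ z : ℝ, 0 < -(N * psi N * Real.exp (-(psi N * z)) *
      ((psi N * z) ^ (N - 1) * Real.exp (-((N - psi N) * z)) -
        (1 - Real.exp (-(psi N * z))) ^ (N - 1))) ↔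
        (psi N * z) ^ (N - 1) * Real.exp (-((N - psi N) * z)) <
          (1 - Real.exp (-(psi N * z))) ^ (N - 1) := by
      intro z
      rw [neg_pos, ← sub_neg (b := (1 - Real.exp (-(psi N * z))) ^ (N - 1))]
      have hp : 0 < N * psi N * Real.exp (-(psi N * z)) := by positivity
      constructor
      · intro h
        by_contra h'
        exact absurd h (not_lt.2 (mul_nonneg hp.le (not_lt.1 h')))
      · exact fun h => mul_neg_of_pos_of_neg hp h
    rw [hsign] at h ⊢
    rcases Nat.lt_or_ge 1 N with h1 | h1
    · have hN1 : ((N - 1 : ℕ) : ℝ) = N - 1 := by rw [Nat.cast_sub hN]; simp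
      have hN2 : (0 : ℝ) < N - 1 := by
        have : (1 : ℝ) < N := by exact_mod_cast h1
        linarith
      -- Both sides are `(N - 1)`-th powers, so that it is enough to compare the bases; the
      -- exponential distributes over the `N - 1` factors with this rate `k`.
      set k : ℝ := (N - psi N) / (psi N * (N - 1)) with hk
      have hpow : ∀ z : ℝ, (psi N * z) ^ (N - 1) * Real.exp (-((N - psi N) * z)) =
          (psi N * z * Real.exp (-(k * (psi N * z)))) ^ (N - 1) := by
        intro z
        rw [mul_pow _ (Real.exp _), ← Real.exp_nat_mul, hN1, hk]
        congr 2
        field_simp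
      have hz : ∀ z : ℝ, 0 < z → 0 ≤ 1 - Real.exp (-(psi N * z)) := by
        intro z hz
        rw [sub_nonneg, Real.exp_le_one_iff]
        have := mul_pos hψ hz
        linarith
      rw [hpow] at h ⊢
      have hy0 := hc.trans_le hy
      refine pow_lt_pow_left₀ ?_ (by positivity) (by omega)
      exact exp_single_crossing k (mul_pos hψ hc) (lt_of_pow_lt_pow_left₀ _ (hz c hc) h)
        (mul_le_mul_of_nonneg_left hy hψ.le)
    · obtain rfl : N = 1 := by omega
      -- for `N = 1` both sides agree, so the assumption is void
      simp [psi] at h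
  have := le_of_tendsto hlim (eventually_atTop.2 ⟨x, hmono⟩)
  linarith

/-! ### First-order differential equations for the hypergeometric functions -/

/-- Termwise differentiation of a power series with radius of convergence `1`, in the form that
multiplies the `n`-th coefficient by `n`. -/
theorem hasSum_deriv_of_hasFPowerSeriesOnBall {c : ℕ → ℝ} {f : ℝ → ℝ}
    (h : HasFPowerSeriesOnBall f (FormalMultilinearSeries.ofScalars ℝ c) 0 1) {w : ℝ}
    (hw : |w| < 1) :
    HasSum (fun n => c n * w ^ n) (f w) ∧
      ∃ f' : ℝ, HasDerivAt f f' w ∧ HasSum (fun n : ℕ => n * c n * w ^ n) (w * f') := by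
  have hmem : w ∈ Metric.eball (0 : ℝ) 1 := by
    simpa [enorm_eq_nnnorm, ← NNReal.coe_lt_coe] using hw
  refine ⟨by simpa [mul_comm] using h.hasSum hmem, ?_⟩
  refine ⟨fderiv ℝ f w 1, ?_, ?_⟩
  · exact (h.analyticAt_of_mem hmem).differentiableAt.hasDerivAt
  · have h1 := h.fderiv.hasSum hmem
    rw [zero_add] at h1
    have h2 := (ContinuousLinearMap.apply ℝ ℝ (1 : ℝ)).hasSum h1
    have h3 : HasSum (fun n : ℕ => (n + 1 : ℝ) * c (n + 1) * w ^ n) (fderiv ℝ f w 1) := by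
      refine h2.congr_fun ?_
      intro n
      have := (FormalMultilinearSeries.ofScalars ℝ c).derivSeries_coeff_one n
      rw [FormalMultilinearSeries.apply_eq_pow_smul_coeff]
      simp only [map_smul, ContinuousLinearMap.apply_apply, this, smul_eq_mul,
        FormalMultilinearSeries.coeff_ofScalars, nsmul_eq_mul]
      push_cast
      ring
    have h4 := h3.mul_left w
    rw [← hasSum_nat_add_iff' 1]
    refine HasSum.congr_fun (by simpa using h4) fun n => ?_
    push_cast
    ring

theorem hasFPowerSeriesOnBall_ordinaryHypergeometric {a b c : ℝ}
    (h : ∀ k : ℕ, (k : ℝ) ≠ -a ∧ (k : ℝ) ≠ -b ∧ (k : ℝ) ≠ -c) :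
    HasFPowerSeriesOnBall (ordinaryHypergeometric a b c : ℝ → ℝ)
      (FormalMultilinearSeries.ofScalars ℝ (ordinaryHypergeometricCoefficient a b c)) 0 1 := by
  have hr := ordinaryHypergeometricSeries_radius_eq_one ℝ a b c h
  have := (ordinaryHypergeometricSeries ℝ a b c).hasFPowerSeriesOnBall (by rw [hr]; simp)
  rw [hr] at this
  exact this

theorem ordinaryHypergeometricCoefficient_succ (a b c : ℝ) (n : ℕ) :
    ordinaryHypergeometricCoefficient a b c (n + 1) =
      ordinaryHypergeometricCoefficient a b c n * ((a + n) * (b + n) / ((c + n) * (n + 1))) := by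
  simp only [ordinaryHypergeometricCoefficient, ascPochhammer_succ_eval, Nat.factorial_succ]
  push_cast
  simp only [mul_inv, div_eq_mul_inv]
  ring

/-- The derivative of `v ↦ F(a, b; c; -v)` in terms of the transformed series at `w = v / (1 + v)`.
The condition `-1 / 2 < v` says that `|w| < 1`; it leaves room for a two-sided derivative at `0`. -/
theorem hasDerivAt_gaussHypergeometric_neg {a b c v S' : ℝ} (hv : -(1 / 2) < v)
    (hS : HasDerivAt (ordinaryHypergeometric a (c - b) c : ℝ → ℝ) S' (v / (1 + v))) :
    ∃ D, HasDerivAt (fun v => gaussHypergeometric a b c (-v)) D v ∧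
      v * D = (1 + v) ^ (-a) *
        (-a * (v / (1 + v)) * (ordinaryHypergeometric a (c - b) c (v / (1 + v)) : ℝ) +
          (1 - v / (1 + v)) * (v / (1 + v) * S')) := by
  have h1 : 0 < 1 + v := by linarith
  have hfun : (fun v => gaussHypergeometric a b c (-v)) =
      fun v => (1 + v) ^ (-a) * (ordinaryHypergeometric a (c - b) c (v / (1 + v)) : ℝ) := by
    ext v
    rw [gaussHypergeometric, show -v / (-v - 1) = v / (1 + v) by
      rw [← neg_div_neg_eq]; ring_nf, sub_neg_eq_add]
  have hw : HasDerivAt (fun v : ℝ => v / (1 + v)) (1 / (1 + v) ^ 2) v := by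
    have := (hasDerivAt_id v).div ((hasDerivAt_id v).const_add 1) h1.ne'
    refine this.congr_deriv ?_
    simp only [id_eq]
    ring_nf
  have hpow : HasDerivAt (fun v : ℝ => (1 + v) ^ (-a)) (-a * (1 + v) ^ (-a - 1)) v := by
    have := ((hasDerivAt_id v).const_add 1).rpow_const (p := -a) (Or.inl h1.ne')
    exact this.congr_deriv (by rw [one_mul]; rfl)
  rw [hfun]
  refine ⟨_, hpow.mul (hS.comp v hw), ?_⟩
  rw [Real.rpow_sub_one h1.ne']
  field_simp
  ring

theorem abs_div_one_add_lt_one {v : ℝ} (hv : -(1 / 2) < v) : |v / (1 + v)| < 1 := by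
  have h1 : 0 < 1 + v := by linarith
  rw [abs_lt, lt_div_iff₀ h1, div_lt_one h1]
  constructor <;> linarith

/-- The differential equation that makes `v ^ b * F(a, b; b + 1; -v)` a primitive of
`b * v ^ (b - 1) * (1 + v) ^ (-a)`. -/
theorem hasDerivAt_gaussHypergeometric_add_one {a b v : ℝ} (ha : 0 < a) (hb : 0 < b)
    (hv : -(1 / 2) < v) :
    ∃ D, HasDerivAt (fun v => gaussHypergeometric a b (b + 1) (-v)) D v ∧
      v * D = b * ((1 + v) ^ (-a) - gaussHypergeometric a b (b + 1) (-v)) := by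
  set w := v / (1 + v) with hw
  have hk : ∀ k : ℕ, (k : ℝ) ≠ -a ∧ (k : ℝ) ≠ -(b + 1 - b) ∧ (k : ℝ) ≠ -(b + 1) := by
    intro k
    have : (0 : ℝ) ≤ k := k.cast_nonneg
    refine ⟨?_, ?_, ?_⟩ <;> linarith
  obtain ⟨hsum, S', hS', hsum'⟩ := hasSum_deriv_of_hasFPowerSeriesOnBall
    (hasFPowerSeriesOnBall_ordinaryHypergeometric hk) (abs_div_one_add_lt_one hv)
  obtain ⟨D, hD, hvD⟩ := hasDerivAt_gaussHypergeometric_neg hv hS'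
  refine ⟨D, hD, ?_⟩
  rw [← hw] at hsum hsum' hvD
  set S : ℝ := ordinaryHypergeometric a (b + 1 - b) (b + 1) w with hSdef
  -- The coefficients satisfy `(b + n + 1) * cₙ₊₁ = (a + n) * cₙ`, so that only the constant term
  -- of the series on the left is left.
  have hode : b * S + w * S' - w * (a * S + w * S') = b := by
    have e1 := (hsum.mul_left b).add hsum'
    have e2 := ((hsum.mul_left a).add hsum').mul_left w
    rw [← hasSum_nat_add_iff' 1] at e1
    have e3 := e1.unique (e2.congr_fun ?_)
    · simp [ordinaryHypergeometricCoefficient] at e3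
      linarith
    intro n
    rw [ordinaryHypergeometricCoefficient_succ]
    have : b + 1 + (n : ℝ) ≠ 0 := by positivity
    have : (n : ℝ) + 1 ≠ 0 := by positivity
    push_cast
    field_simp
    ring
  have hF : gaussHypergeometric a b (b + 1) (-v) = (1 + v) ^ (-a) * S := by
    rw [gaussHypergeometric, show -v / (-v - 1) = v / (1 + v) by
      rw [← neg_div_neg_eq]; ring_nf, sub_neg_eq_add]
  rw [hvD, hF]
  linear_combination (1 + v) ^ (-a) * hode

theorem ringChoose_add_sub_one (A : ℝ) (n : ℕ) :
    Ring.choose (A + n - 1) n = (n.factorial : ℝ)⁻¹ * (ascPochhammer ℝ n).eval A := by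
  have h : Ring.choose (A + n - 1) n = Ring.multichoose A n := by
    rw [Ring.choose]; ring_nf
  have h2 := Ring.factorial_nsmul_multichoose_eq_ascPochhammer A n
  rw [nsmul_eq_mul, Polynomial.ascPochhammer_smeval_eq_eval] at h2
  rw [h, ← h2, inv_mul_cancel_left₀ (by positivity)]

/-- The differential equation that makes `v ^ (-δ) * F(-δ, N; 1 - δ; -v)` a primitive of
`-δ * v ^ (-δ - 1) * (1 + v) ^ (-N)`. -/
theorem hasDerivAt_gaussHypergeometric_neg_delta {δ v : ℝ} {N : ℕ} (hδ : 0 < δ) (hδ1 : δ < 1)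
    (hv : -(1 / 2) < v) :
    ∃ D, HasDerivAt (fun v => gaussHypergeometric (-δ) N (1 - δ) (-v)) D v ∧
      v * D = δ * (gaussHypergeometric (-δ) N (1 - δ) (-v) - (1 + v) ^ (-(N : ℝ))) := by
  set w := v / (1 + v) with hw
  have h1 : 0 < 1 + v := by linarith
  have hint : ∀ k : ℤ, (k : ℝ) ≠ δ := by
    rintro k rfl
    have h1 : 0 < k := by exact_mod_cast hδ
    have h2 : k < 1 := by exact_mod_cast hδ1
    omega
  have hk : ∀ k : ℕ, (k : ℝ) ≠ - -δ ∧ (k : ℝ) ≠ -(1 - δ - N) ∧ (k : ℝ) ≠ -(1 - δ) := by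
    intro k
    have : (0 : ℝ) ≤ k := k.cast_nonneg
    refine ⟨?_, ?_, by linarith⟩
    · have := hint k
      simpa using this
    · have := hint (k + 1 - N)
      push_cast at this
      contrapose! this
      linarith
  obtain ⟨hsum, S', hS', hsum'⟩ := hasSum_deriv_of_hasFPowerSeriesOnBall
    (hasFPowerSeriesOnBall_ordinaryHypergeometric hk) (abs_div_one_add_lt_one hv)
  obtain ⟨D, hD, hvD⟩ := hasDerivAt_gaussHypergeometric_neg hv hS'
  refine ⟨D, hD, ?_⟩
  obtain ⟨hbin, -⟩ := hasSum_deriv_of_hasFPowerSeriesOnBall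
    (Real.one_div_one_sub_rpow_hasFPowerSeriesOnBall_zero (1 - δ - N)) (abs_div_one_add_lt_one hv)
  rw [← hw] at hsum hsum' hvD hbin
  set S : ℝ := ordinaryHypergeometric (-δ) (1 - δ - N) (1 - δ) w with hSdef
  -- The factor `n - δ` cancels the quotient of Pochhammer symbols `(-δ)ₙ / (1 - δ)ₙ` to `-δ`, and
  -- the binomial series is left.
  have hode : w * S' - δ * S = -δ * (1 / (1 - w) ^ (1 - δ - N)) := by
    refine (hsum'.sub (hsum.mul_left δ)).unique ((hbin.mul_left (-δ)).congr_fun ?_)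
    intro n
    rw [ringChoose_add_sub_one, ordinaryHypergeometricCoefficient]
    have hp : ∀ n : ℕ, (ascPochhammer ℝ n).eval (-δ) * (n - δ) =
        -δ * (ascPochhammer ℝ n).eval (1 - δ) := by
      intro n
      induction n with
      | zero => simp
      | succ n ih =>
        rw [ascPochhammer_succ_eval, ascPochhammer_succ_eval]
        push_cast
        linear_combination (n + 1 - δ) * ih
    have hne : (ascPochhammer ℝ n).eval (1 - δ) ≠ 0 :=
      (ascPochhammer_pos n _ (by linarith)).ne'
    have := hp n
    field_simp
    linear_combination (ascPochhammer ℝ n).eval (1 - δ - N) * w ^ n * this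
  have hF : gaussHypergeometric (-δ) N (1 - δ) (-v) = (1 + v) ^ (- -δ) * S := by
    rw [gaussHypergeometric, show -v / (-v - 1) = v / (1 + v) by
      rw [← neg_div_neg_eq]; ring_nf, sub_neg_eq_add]
  have hw1 : 1 - w = (1 + v)⁻¹ := by
    rw [hw]; field_simp; ring
  have hpow : (1 + v) ^ (- -δ) * ((1 - w) * (1 / (1 - w) ^ (1 - δ - N))) =
      (1 + v) ^ (-(N : ℝ)) := by
    rw [hw1, Real.inv_rpow h1.le, one_div, inv_inv, ← Real.rpow_neg_one, ← Real.rpow_add h1,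
      ← Real.rpow_add h1]
    ring_nf
  rw [hvD, hF, ← hpow]
  linear_combination (1 + v) ^ (- -δ) * (1 - w) * hode

/-! ### The spatial integral in the Laplace transform of the interference -/

/-- The differential equation `v ρ_L'(v) = (2 / α) ((v / (1 + v)) ^ N - ρ_L(v))`. -/
theorem hasDerivAt_rhoL (p : Params) {v : ℝ} (hv : 0 < v) :
    ∃ D, HasDerivAt (rhoL p) D v ∧
      v * D = 2 / p.expo Link.los * ((v / (1 + v)) ^ p.N Link.los - rhoL p v) := by
  have hα := p.expo_los_pos
  have hN : (0 : ℝ) < p.N Link.los := by exact_mod_cast p.N_pos Link.los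
  obtain ⟨D, hD, hvD⟩ := hasDerivAt_gaussHypergeometric_add_one (a := p.N Link.los)
    (b := p.N Link.los + 2 / p.expo Link.los) hN (by positivity) (v := v) (by linarith)
  have hpow : HasDerivAt (fun v : ℝ => 2 * v ^ p.N Link.los)
      (2 * (p.N Link.los * v ^ (p.N Link.los - 1))) v :=
    (hasDerivAt_pow _ v).const_mul 2
  refine ⟨_, (hD.mul hpow).div_const _, ?_⟩
  have hvp : v * v ^ (p.N Link.los - 1) = v ^ p.N Link.los := by
    rw [← pow_succ', Nat.sub_add_cancel (p.N_pos _)]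
  have hr : (1 + v) ^ (-(p.N Link.los : ℝ)) = ((1 + v) ^ p.N Link.los)⁻¹ := by
    rw [Real.rpow_neg (by linarith), Real.rpow_natCast]
  rw [hr] at hvD
  rw [rhoL]
  set H := gaussHypergeometric (p.N Link.los) (p.N Link.los + 2 / p.expo Link.los)
      (p.N Link.los + 2 / p.expo Link.los + 1) (-v)
  calc v * ((D * (2 * v ^ p.N Link.los) + H * (2 * (p.N Link.los * v ^ (p.N Link.los - 1)))) /
        (p.expo Link.los * p.N Link.los + 2))
      = ((v * D) * (2 * v ^ p.N Link.los) +
          H * (2 * (p.N Link.los * (v * v ^ (p.N Link.los - 1))))) /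
        (p.expo Link.los * p.N Link.los + 2) := by ring
    _ = _ := by
        rw [hvD, hvp, div_pow]
        field_simp
        ring

theorem continuousAt_rhoL (p : Params) {v : ℝ} (hv : 0 ≤ v) : ContinuousAt (rhoL p) v := by
  have hα := p.expo_los_pos
  have hN : (0 : ℝ) < p.N Link.los := by exact_mod_cast p.N_pos Link.los
  obtain ⟨D, hD, -⟩ := hasDerivAt_gaussHypergeometric_add_one (a := p.N Link.los)
    (b := p.N Link.los + 2 / p.expo Link.los) hN (by positivity) (v := v) (by linarith)
  exact (hD.continuousAt.mul
    (by fun_prop : ContinuousAt (fun v : ℝ => 2 * v ^ p.N Link.los) v)).div_const _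

/-- The differential equation `v ρ_N'(v) = (2 / α) (ρ_N(v) - (1 + v) ^ (-N))`. -/
theorem hasDerivAt_rhoN (p : Params) {v : ℝ} (hv : 0 ≤ v) :
    ∃ D, HasDerivAt (rhoN p) D v ∧
      v * D = 2 / p.expo Link.nlos * (rhoN p v - ((1 + v) ^ p.N Link.nlos)⁻¹) := by
  have hα := p.two_lt_expo_nlos
  obtain ⟨D, hD, hvD⟩ := hasDerivAt_gaussHypergeometric_neg_delta (δ := 2 / p.expo Link.nlos)
    (N := p.N Link.nlos) (by positivity) ((div_lt_one (by linarith)).2 hα) (v := v) (by linarith)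
  refine ⟨D, hD, ?_⟩
  rw [hvD, Real.rpow_neg (by linarith), Real.rpow_natCast]
  rfl

theorem rhoN_zero (p : Params) : rhoN p 0 = 1 := by
  simp [rhoN, gaussHypergeometric]

/-- The conditional Laplace transform at `y` of the power received over a link of length `r`,
before the Fejér gain is applied: `E exp (-y M |g|² Lp(r))`. -/
noncomputable def linkLaplace (p : Params) (y r : ℝ) : ℝ :=
  ((1 + y * (p.M * p.pathLoss r) / p.N (p.link r)) ^ p.N (p.link r))⁻¹

/-- The normalized exponent of the Laplace transform of the interference, as a function of
`y = s * fejer M x`. -/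
noncomputable def radialExponent (p : Params) (y : ℝ) : ℝ :=
  if y = 0 then 0
  else rhoN p (y * (p.M * p.C Link.nlos) / p.N Link.nlos * p.RL ^ (-p.expo Link.nlos)) -
    rhoL p (p.RL ^ p.expo Link.los / (y * (p.M * p.C Link.los) / p.N Link.los))

theorem quadIntegrand_eq (p : Params) (s x : ℝ) :
    quadIntegrand p s x = radialExponent p (s * fejer p.M x) := by
  unfold quadIntegrand radialExponent
  have h1 : (0 : ℝ) < p.N Link.los := by exact_mod_cast p.N_pos Link.los
  have h3 : 0 < p.RL := p.RL_pos
  congr 2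
  · rw [Real.rpow_neg h3.le]
    congr 1
    rw [div_mul_eq_mul_div, ← div_eq_mul_inv, div_div, mul_comm (p.N Link.nlos : ℝ)]
    ring_nf
  · congr 1
    rw [div_div_eq_mul_div]
    ring_nf

/-- The line-of-sight part of the radial integral: `r² (1 - ρ_L(r ^ α / u))` is a primitive. The
rate `u` collects the constants of the link. -/
theorem integral_los_link (p : Params) {u : ℝ} (hu : 0 < u) :
    IntegrableOn (fun r => 2 * (r * (1 - ((1 + u * r ^ (-p.expo Link.los)) ^ p.N Link.los)⁻¹)))
      (Ioc 0 p.RL) ∧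
    ∫ r in Ioc 0 p.RL, 2 * (r * (1 - ((1 + u * r ^ (-p.expo Link.los)) ^ p.N Link.los)⁻¹)) =
      p.RL ^ 2 * (1 - rhoL p (p.RL ^ p.expo Link.los / u)) := by
  have hα := p.expo_los_pos
  set α := p.expo Link.los
  have hcont : ContinuousOn (fun r => r ^ 2 * (1 - rhoL p (r ^ α / u))) (Icc 0 p.RL) := by
    intro r hr
    refine ContinuousAt.continuousWithinAt ?_
    have h1 : ContinuousAt (fun r : ℝ => r ^ α / u) r :=
      (Real.continuousAt_rpow_const r α (Or.inr hα.le)).div_const u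
    have h2 : ContinuousAt (rhoL p) (r ^ α / u) :=
      continuousAt_rhoL p (div_nonneg (Real.rpow_nonneg hr.1 _) hu.le)
    exact (continuousAt_id.pow 2).mul (continuousAt_const.sub
      (ContinuousAt.comp (f := fun r : ℝ => r ^ α / u) h2 h1))
  have hderiv : ∀ r ∈ Ioo 0 p.RL, HasDerivAt (fun r => r ^ 2 * (1 - rhoL p (r ^ α / u)))
      (2 * (r * (1 - ((1 + u * r ^ (-α)) ^ p.N Link.los)⁻¹))) r := by
    intro r hr
    have hr0 : 0 < r := hr.1
    have hrα : 0 < r ^ α := Real.rpow_pos_of_pos hr0 _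
    obtain ⟨D, hD, hvD⟩ := hasDerivAt_rhoL p (v := r ^ α / u) (by positivity)
    have h1 : HasDerivAt (fun r : ℝ => r ^ α / u) (α * r ^ (α - 1) / u) r :=
      (Real.hasDerivAt_rpow_const (Or.inl hr0.ne')).div_const u
    have h2 := (hasDerivAt_pow 2 r).mul ((hD.comp r h1).const_sub 1)
    refine h2.congr_deriv ?_
    have e1 : 1 + u * r ^ (-α) = (r ^ α / u / (1 + r ^ α / u))⁻¹ := by
      rw [Real.rpow_neg hr0.le]
      field_simp
      ring
    have e2 : r ^ 2 * (D * (α * r ^ (α - 1) / u)) = α * r * (r ^ α / u * D) := by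
      rw [Real.rpow_sub_one hr0.ne']
      field_simp
    rw [e1, inv_pow, inv_inv, mul_neg, e2, hvD]
    change _ + -(α * r * (2 / α * _)) = _
    simp only [Function.comp]
    field_simp
    ring
  have hnonneg : ∀ r ∈ Ioo 0 p.RL, 0 ≤ 2 * (r * (1 - ((1 + u * r ^ (-α)) ^ p.N Link.los)⁻¹)) := by
    intro r hr
    have hr0 : 0 < r := hr.1
    have : ((1 + u * r ^ (-α)) ^ p.N Link.los)⁻¹ ≤ 1 :=
      inv_le_one_of_one_le₀ (one_le_pow₀ (by
        have : 0 ≤ u * r ^ (-α) := by positivity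
        linarith))
    have : 0 ≤ 1 - ((1 + u * r ^ (-α)) ^ p.N Link.los)⁻¹ := by linarith
    positivity
  have hint := intervalIntegral.integrableOn_deriv_of_nonneg hcont hderiv hnonneg
  refine ⟨hint, ?_⟩
  rw [← intervalIntegral.integral_of_le p.RL_pos.le,
    intervalIntegral.integral_eq_sub_of_hasDerivAt_of_le p.RL_pos.le hcont hderiv
      ((intervalIntegrable_iff_integrableOn_Ioc_of_le p.RL_pos.le).2 hint)]
  simp

/-- The part of the radial integral without line of sight: `-r² (ρ_N(u r ^ (-α)) - 1)` is a
primitive, and vanishes at infinity because `α > 2`. -/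
theorem integral_nlos_link (p : Params) {u : ℝ} (hu : 0 < u) :
    IntegrableOn (fun r => 2 * (r * (1 - ((1 + u * r ^ (-p.expo Link.nlos)) ^ p.N Link.nlos)⁻¹)))
      (Ioi p.RL) ∧
    ∫ r in Ioi p.RL, 2 * (r * (1 - ((1 + u * r ^ (-p.expo Link.nlos)) ^ p.N Link.nlos)⁻¹)) =
      p.RL ^ 2 * (rhoN p (u * p.RL ^ (-p.expo Link.nlos)) - 1) := by
  have hα := p.two_lt_expo_nlos
  have hR := p.RL_pos
  set α := p.expo Link.nlos
  have hderiv : ∀ r, 0 < r → HasDerivAt (fun r => -(r ^ 2 * (rhoN p (u * r ^ (-α)) - 1)))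
      (2 * (r * (1 - ((1 + u * r ^ (-α)) ^ p.N Link.nlos)⁻¹))) r := by
    intro r hr0
    have hrα : 0 < r ^ (-α) := Real.rpow_pos_of_pos hr0 _
    obtain ⟨D, hD, hvD⟩ := hasDerivAt_rhoN p (v := u * r ^ (-α)) (by positivity)
    have h1 : HasDerivAt (fun r : ℝ => u * r ^ (-α)) (u * (-α * r ^ (-α - 1))) r :=
      (Real.hasDerivAt_rpow_const (Or.inl hr0.ne')).const_mul u
    have h2 := ((hasDerivAt_pow 2 r).mul ((hD.comp r h1).sub_const 1)).neg
    refine h2.congr_deriv ?_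
    have e2 : r ^ 2 * (D * (u * (-α * r ^ (-α - 1)))) = -α * r * (u * r ^ (-α) * D) := by
      rw [Real.rpow_sub_one hr0.ne']
      field_simp
    rw [e2, hvD]
    simp only [Function.comp]
    have : α ≠ 0 := by linarith
    change -(_ + -α * r * (2 / α * _)) = _
    field_simp
    ring
  have hnonneg : ∀ r ∈ Ioi p.RL, 0 ≤ 2 * (r * (1 - ((1 + u * r ^ (-α)) ^ p.N Link.nlos)⁻¹)) := by
    intro r hr
    have hr0 : 0 < r := hR.trans hr
    have : ((1 + u * r ^ (-α)) ^ p.N Link.nlos)⁻¹ ≤ 1 :=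
      inv_le_one_of_one_le₀ (one_le_pow₀ (by
        have : 0 ≤ u * r ^ (-α) := by positivity
        linarith))
    have : 0 ≤ 1 - ((1 + u * r ^ (-α)) ^ p.N Link.nlos)⁻¹ := by linarith
    positivity
  have hlim : Tendsto (fun r => -(r ^ 2 * (rhoN p (u * r ^ (-α)) - 1))) atTop (𝓝 0) := by
    -- a difference quotient of `rhoN` at `0`, times `u * r ^ (2 - α)`
    obtain ⟨D, hD, -⟩ := hasDerivAt_rhoN p (v := 0) le_rfl
    rw [hasDerivAt_iff_tendsto_slope] at hD
    have h1 : Tendsto (fun r : ℝ => u * r ^ (-α)) atTop (𝓝[≠] 0) := by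
      refine tendsto_nhdsWithin_iff.2 ⟨?_, ?_⟩
      · simpa using (tendsto_rpow_neg_atTop (by linarith : 0 < α)).const_mul u
      · filter_upwards [eventually_gt_atTop 0] with r hr
        have := Real.rpow_pos_of_pos hr (-α)
        exact (mul_pos hu this).ne'
    have h2 : Tendsto (fun r : ℝ => u * r ^ (-(α - 2))) atTop (𝓝 0) := by
      simpa using (tendsto_rpow_neg_atTop (by linarith : 0 < α - 2)).const_mul u
    have h3 := ((hD.comp h1).mul h2).neg
    rw [mul_zero, neg_zero] at h3
    refine h3.congr' ?_
    filter_upwards [eventually_gt_atTop 0] with r hr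
    have := Real.rpow_pos_of_pos hr (-α)
    have e : r ^ (-(α - 2)) = r ^ (-α) * r ^ 2 := by
      rw [← Real.rpow_natCast, ← Real.rpow_add hr]
      push_cast
      ring_nf
    simp only [Function.comp, slope, vsub_eq_sub, sub_zero, smul_eq_mul, rhoN_zero, e]
    field_simp
  have hcont : ContinuousWithinAt (fun r => -(r ^ 2 * (rhoN p (u * r ^ (-α)) - 1))) (Ici p.RL)
      p.RL := (hderiv p.RL hR).continuousAt.continuousWithinAt
  have hd : ∀ r ∈ Ioi p.RL, HasDerivAt (fun r => -(r ^ 2 * (rhoN p (u * r ^ (-α)) - 1)))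
      (2 * (r * (1 - ((1 + u * r ^ (-α)) ^ p.N Link.nlos)⁻¹))) r :=
    fun r hr => hderiv r (hR.trans hr)
  refine ⟨integrableOn_Ioi_deriv_of_nonneg hcont hd hnonneg hlim, ?_⟩
  rw [integral_Ioi_of_hasDerivAt_of_nonneg hcont hd hnonneg hlim]
  ring

theorem link_of_le (p : Params) {r : ℝ} (h : r ≤ p.RL) : p.link r = Link.los := if_pos h

theorem link_of_lt (p : Params) {r : ℝ} (h : p.RL < r) : p.link r = Link.nlos :=
  if_neg (not_le.2 h)

/-- The radial integral of `1 - linkLaplace` is given by the hypergeometric closed form. -/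
theorem integral_radial (p : Params) {y : ℝ} (hy : 0 ≤ y) :
    IntegrableOn (fun r => 2 * (r * (1 - linkLaplace p y r))) (Ioi 0) ∧
      ∫ r in Ioi 0, 2 * (r * (1 - linkLaplace p y r)) = p.RL ^ 2 * radialExponent p y := by
  rcases hy.eq_or_lt with rfl | hy
  · simp [linkLaplace, radialExponent]
  have hu : ∀ κ, 0 < y * (p.M * p.C κ) / p.N κ := by
    intro κ
    have h1 : (0 : ℝ) < p.N κ := by exact_mod_cast p.N_pos κ
    have h2 : (0 : ℝ) < p.M := by exact_mod_cast p.M_pos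
    have h3 := p.C_pos κ
    positivity
  have e1 : EqOn (fun r => 2 * (r * (1 - linkLaplace p y r)))
      (fun r => 2 * (r * (1 - ((1 + y * (p.M * p.C Link.los) / p.N Link.los *
        r ^ (-p.expo Link.los)) ^ p.N Link.los)⁻¹))) (Ioc 0 p.RL) := by
    intro r hr
    simp only [linkLaplace, Params.pathLoss, link_of_le p hr.2]
    congr 6
    ring
  have e2 : EqOn (fun r => 2 * (r * (1 - linkLaplace p y r)))
      (fun r => 2 * (r * (1 - ((1 + y * (p.M * p.C Link.nlos) / p.N Link.nlos *
        r ^ (-p.expo Link.nlos)) ^ p.N Link.nlos)⁻¹))) (Ioi p.RL) := by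
    intro r hr
    simp only [linkLaplace, Params.pathLoss, link_of_lt p hr]
    congr 6
    ring
  obtain ⟨i1, h1⟩ := integral_los_link p (hu Link.los)
  obtain ⟨i2, h2⟩ := integral_nlos_link p (hu Link.nlos)
  have j1 := i1.congr_fun e1.symm measurableSet_Ioc
  have j2 := i2.congr_fun e2.symm measurableSet_Ioi
  rw [← Ioc_union_Ioi_eq_Ioi p.RL_pos.le]
  refine ⟨j1.union j2, ?_⟩
  rw [setIntegral_union (Ioc_disjoint_Ioi le_rfl) measurableSet_Ioi j1 j2,
    setIntegral_congr_fun measurableSet_Ioc e1, setIntegral_congr_fun measurableSet_Ioi e2, h1, h2,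
    radialExponent, if_neg hy.ne']
  ring

theorem pathLoss_nonneg (p : Params) {r : ℝ} (hr : 0 ≤ r) : 0 ≤ p.pathLoss r :=
  mul_nonneg (p.C_pos _).le (Real.rpow_nonneg hr _)

theorem one_le_linkLaplace_base (p : Params) {y r : ℝ} (hy : 0 ≤ y) (hr : 0 ≤ r) :
    1 ≤ 1 + y * (p.M * p.pathLoss r) / p.N (p.link r) := by
  have := pathLoss_nonneg p hr
  have : 0 ≤ y * (p.M * p.pathLoss r) / p.N (p.link r) := by positivity
  linarith

theorem linkLaplace_pos (p : Params) {y r : ℝ} (hy : 0 ≤ y) (hr : 0 ≤ r) :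
    0 < linkLaplace p y r :=
  inv_pos.2 (pow_pos (one_pos.trans_le (one_le_linkLaplace_base p hy hr)) _)

theorem linkLaplace_le_one (p : Params) {y r : ℝ} (hy : 0 ≤ y) (hr : 0 ≤ r) :
    linkLaplace p y r ≤ 1 :=
  inv_le_one_of_one_le₀ (one_le_pow₀ (one_le_linkLaplace_base p hy hr))

theorem linkLaplace_anti (p : Params) {y z r : ℝ} (hy : 0 ≤ y) (hyz : y ≤ z) (hr : 0 ≤ r) :
    linkLaplace p z r ≤ linkLaplace p y r := by
  have := pathLoss_nonneg p hr
  have h1 := one_le_linkLaplace_base p hy hr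
  refine inv_anti₀ (pow_pos (one_pos.trans_le h1) _)
    (pow_le_pow_left₀ (one_pos.trans_le h1).le ?_ _)
  gcongr

theorem continuousOn_linkLaplace (p : Params) {r : ℝ} (hr : 0 ≤ r) :
    ContinuousOn (fun y => linkLaplace p y r) (Ici 0) := by
  refine ContinuousOn.inv₀ (by fun_prop) fun y hy => ?_
  exact (pow_pos (one_pos.trans_le (one_le_linkLaplace_base p hy hr)) _).ne'

/-- Measurability of an expression that depends on the state of a link. -/
theorem measurable_link_rec (p : Params) {α : Type*} [MeasurableSpace α] {β : Type*}
    [MeasurableSpace β] {r : α → ℝ} (hr : Measurable r) {f : Link → α → β}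
    (hf : ∀ κ, Measurable (f κ)) : Measurable fun a => f (p.link (r a)) a := by
  have : (fun a => f (p.link (r a)) a) =
      fun a => if r a ≤ p.RL then f Link.los a else f Link.nlos a := by
    ext a
    unfold Params.link
    split_ifs <;> rfl
  rw [this]
  exact Measurable.ite (measurableSet_le hr measurable_const) (hf _) (hf _)

theorem measurable_pathLoss (p : Params) : Measurable p.pathLoss :=
  measurable_link_rec p measurable_id (f := fun κ r => p.C κ * r ^ (-p.expo κ))
    (fun κ => by fun_prop)

theorem measurable_linkLaplace (p : Params) :
    Measurable fun z : ℝ × ℝ => linkLaplace p z.1 z.2 := by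
  refine measurable_link_rec p measurable_snd
    (f := fun κ z => ((1 + z.1 * (p.M * p.pathLoss z.2) / p.N κ) ^ p.N κ)⁻¹) (fun κ => ?_)
  have := measurable_pathLoss p
  fun_prop

theorem finrank_plane : Module.finrank ℝ Plane = 2 := by simp [Plane]

theorem volume_real_unit_ball_plane :
    (volume : Measure Plane).real (Metric.ball 0 1) = Real.pi := by
  rw [measureReal_def, EuclideanSpace.volume_ball_fin_two]
  simp [Real.pi_pos.le]

/-- The spatial integral in the exponent of the Laplace functional, in closed form. -/
theorem integral_plane_linkLaplace (p : Params) {y : ℝ} (hy : 0 ≤ y) :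
    Integrable (fun z : Plane => 1 - linkLaplace p y ‖z‖) ∧
      ∫ z : Plane, (1 - linkLaplace p y ‖z‖) = Real.pi * p.RL ^ 2 * radialExponent p y := by
  obtain ⟨h1, h2⟩ := integral_radial p hy
  rw [integrable_fun_norm_addHaar volume (f := fun r => 1 - linkLaplace p y r),
    integral_fun_norm_addHaar volume (fun r => 1 - linkLaplace p y r), finrank_plane,
    volume_real_unit_ball_plane]
  simp only [Nat.add_one_sub_one, pow_one, smul_eq_mul, nsmul_eq_mul]
  constructor
  · have := h1.div_const 2
    refine this.congr (ae_of_all _ fun r => ?_)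
    ring
  · rw [integral_const_mul] at h2
    push_cast
    linear_combination Real.pi * h2

theorem radialExponent_nonneg (p : Params) {y : ℝ} (hy : 0 ≤ y) : 0 ≤ radialExponent p y := by
  have h := (integral_plane_linkLaplace p hy).2
  have h2 : 0 ≤ ∫ z : Plane, (1 - linkLaplace p y ‖z‖) :=
    integral_nonneg fun z => sub_nonneg.2 (linkLaplace_le_one p hy (norm_nonneg _))
  rw [h] at h2
  have : 0 < Real.pi * p.RL ^ 2 := mul_pos Real.pi_pos (pow_pos p.RL_pos 2)
  exact nonneg_of_mul_nonneg_right h2 this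

/-- Continuity at `y = 0`, where the argument of `rhoL` in the closed form tends to infinity, is
read off the integral representation. -/
theorem continuousOn_radialExponent (p : Params) : ContinuousOn (radialExponent p) (Ici 0) := by
  have hc : 0 < Real.pi * p.RL ^ 2 := mul_pos Real.pi_pos (pow_pos p.RL_pos 2)
  have h : ContinuousOn (fun y => ∫ z : Plane, (1 - linkLaplace p y ‖z‖)) (Ici 0) := by
    intro y hy
    have hev : ∀ᶠ x in 𝓝[Ici 0] y, 0 ≤ x ∧ x ≤ y + 1 := by
      filter_upwards [self_mem_nhdsWithin, mem_nhdsWithin_of_mem_nhds (Iic_mem_nhds (lt_add_one y))]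
        with x h1 h2 using ⟨h1, h2⟩
    refine continuousWithinAt_of_dominated (bound := fun z : Plane => 1 - linkLaplace p (y + 1) ‖z‖)
      ?_ ?_ ?_ ?_
    · filter_upwards [hev] with x hx
      exact (integral_plane_linkLaplace p hx.1).1.aestronglyMeasurable
    · filter_upwards [hev] with x hx
      refine ae_of_all _ fun z => ?_
      rw [Real.norm_of_nonneg (sub_nonneg.2 (linkLaplace_le_one p hx.1 (norm_nonneg _)))]
      linarith [linkLaplace_anti p hx.1 hx.2 (norm_nonneg z)]
    · exact (integral_plane_linkLaplace p (by linarith [mem_Ici.1 hy])).1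
    · exact ae_of_all _ fun z =>
        continuousWithinAt_const.sub (continuousOn_linkLaplace p (norm_nonneg z) y hy)
  refine (h.div_const (Real.pi * p.RL ^ 2)).congr fun y hy => ?_
  exact ((div_eq_iff hc.ne').2 ((integral_plane_linkLaplace p hy).2.trans (mul_comm _ _))).symm

/-! ### The Fejér kernel and Gauss-Chebyshev quadrature -/

/-- The Fejér kernel is a polynomial in `cos (π x)`, through the Chebyshev polynomial of the second
kind. -/
theorem fejer_eq_chebyshev {M : ℕ} (hM : 0 < M) (x : ℝ) :
    fejer M x =
      ((Polynomial.Chebyshev.U ℝ ((M : ℤ) - 1)).eval (Real.cos (Real.pi * x)) / M) ^ 2 := by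
  have hM' : (M : ℝ) ≠ 0 := by positivity
  rw [fejer]
  split_ifs with h
  · have hone : ∀ n : ℤ, ((n.negOnePow : ℤ) : ℝ) ^ 2 = 1 := by
      intro n
      rcases Int.even_or_odd n with hn | hn
      · simp [Int.negOnePow_even n hn]
      · simp [Int.negOnePow_odd n hn]
    rcases Real.sin_eq_zero_iff_cos_eq.1 h with h | h
    · rw [h, Polynomial.Chebyshev.U_eval_one]
      push_cast
      field_simp
      ring
    · rw [h, Polynomial.Chebyshev.U_eval_neg_one, div_pow, mul_pow, hone]
      push_cast
      field_simp
      ring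
  · have := Polynomial.Chebyshev.U_real_cos (Real.pi * x) ((M : ℤ) - 1)
    have e : (((M : ℤ) - 1 : ℤ) + 1 : ℝ) * (Real.pi * x) = Real.pi * M * x := by
      push_cast; ring
    rw [e] at this
    rw [← this]
    field_simp

theorem continuous_fejer {M : ℕ} (hM : 0 < M) : Continuous (fejer M) := by
  have : fejer M = fun x =>
      ((Polynomial.Chebyshev.U ℝ ((M : ℤ) - 1)).eval (Real.cos (Real.pi * x)) / M) ^ 2 :=
    funext (fejer_eq_chebyshev hM)
  rw [this]
  fun_prop

theorem fejer_nonneg (M : ℕ) (x : ℝ) : 0 ≤ fejer M x := by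
  unfold fejer
  split_ifs <;> positivity

/-- Extending by the value at `0` makes the exponent continuous on the whole line. -/
theorem continuous_radialExponent_max (p : Params) :
    Continuous fun y => radialExponent p (max y 0) :=
  (continuousOn_radialExponent p).comp_continuous (by fun_prop) fun y => le_max_right y 0

theorem quadIntegrand_eq_max (p : Params) {s : ℝ} (hs : 0 ≤ s) (x : ℝ) :
    quadIntegrand p s x = radialExponent p (max (s * fejer p.M x) 0) := by
  rw [quadIntegrand_eq, max_eq_left (mul_nonneg hs (fejer_nonneg _ _))]

theorem continuous_quadIntegrand (p : Params) {s : ℝ} (hs : 0 ≤ s) :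
    Continuous (quadIntegrand p s) := by
  rw [funext (quadIntegrand_eq_max p hs)]
  have := continuous_fejer p.M_pos
  exact (continuous_radialExponent_max p).comp (by fun_prop)

theorem quadIntegrand_nonneg (p : Params) {s : ℝ} (hs : 0 ≤ s) (x : ℝ) :
    0 ≤ quadIntegrand p s x := by
  rw [quadIntegrand_eq]
  exact radialExponent_nonneg p (mul_nonneg hs (fejer_nonneg _ _))

/-- Convergence of the midpoint rule on `[0, π]`. -/
theorem tendsto_midpoint_sum {φ : ℝ → ℝ} (hφ : Continuous φ) :
    Tendsto (fun n : ℕ => Real.pi / n *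
      ∑ i ∈ Finset.Icc 1 n, φ ((2 * i - 1) / (2 * n) * Real.pi)) atTop
      (𝓝 (∫ t in (0)..Real.pi, φ t)) := by
  have hπ := Real.pi_pos
  rw [Metric.tendsto_atTop]
  intro ε hε
  have huc := isCompact_Icc.uniformContinuousOn_of_continuous
    (hφ.continuousOn (s := Icc 0 Real.pi))
  rw [Metric.uniformContinuousOn_iff] at huc
  obtain ⟨δ, hδ, hδ'⟩ := huc (ε / (2 * Real.pi)) (by positivity)
  obtain ⟨n₀, hn₀⟩ := exists_nat_gt (Real.pi / δ)
  refine ⟨max n₀ 1, fun n hn => ?_⟩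
  have hn1 : 1 ≤ n := (le_max_right _ _).trans hn
  have hn0 : (0 : ℝ) < n := by exact_mod_cast hn1
  have hmesh : Real.pi / n < δ := by
    have : (n₀ : ℝ) ≤ n := by exact_mod_cast (le_max_left _ _).trans hn
    rw [div_lt_comm₀ hn0 hδ]
    linarith
  have hsum : ∑ i ∈ Finset.Icc 1 n, φ ((2 * i - 1) / (2 * n) * Real.pi) =
      ∑ j ∈ Finset.range n, φ ((2 * j + 1) / (2 * n) * Real.pi) := by
    rw [Finset.range_eq_Ico, Finset.sum_Ico_eq_sum_range, ← Finset.Ico_add_one_right_eq_Icc,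
      Finset.sum_Ico_eq_sum_range]
    refine Finset.sum_congr (by simp) fun j _ => ?_
    push_cast
    ring_nf
  have hint : ∫ t in (0)..Real.pi, φ t =
      ∑ j ∈ Finset.range n, ∫ t in (j * (Real.pi / n))..((j + 1 : ℕ) * (Real.pi / n)), φ t := by
    rw [intervalIntegral.sum_integral_adjacent_intervals (a := fun j : ℕ => (j : ℝ) * (Real.pi / n))
      (fun k _ => hφ.intervalIntegrable _ _)]
    congr 1
    · simp
    · field_simp
  have hpiece : ∀ j ∈ Finset.range n,
      ‖Real.pi / n * φ ((2 * j + 1) / (2 * n) * Real.pi) -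
        ∫ t in (j * (Real.pi / n))..((j + 1 : ℕ) * (Real.pi / n)), φ t‖ ≤
        ε / (2 * Real.pi) * (Real.pi / n) := by
    intro j hj
    have hj' : (j : ℝ) + 1 ≤ n := by exact_mod_cast Finset.mem_range.1 hj
    have hlen : ((j + 1 : ℕ) : ℝ) * (Real.pi / n) - j * (Real.pi / n) = Real.pi / n := by
      push_cast; ring
    have hle : (j : ℝ) * (Real.pi / n) ≤ ((j + 1 : ℕ) : ℝ) * (Real.pi / n) := by
      have : 0 < Real.pi / n := by positivity
      linarith
    have hc : ∫ _ in (j * (Real.pi / n))..((j + 1 : ℕ) * (Real.pi / n)),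
        φ ((2 * j + 1) / (2 * n) * Real.pi) =
          Real.pi / n * φ ((2 * j + 1) / (2 * n) * Real.pi) := by
      rw [intervalIntegral.integral_const, hlen, smul_eq_mul]
    rw [← hc, ← intervalIntegral.integral_sub (by simp) (hφ.intervalIntegrable _ _)]
    have hend : ((j + 1 : ℕ) : ℝ) * (Real.pi / n) ≤ Real.pi := by
      push_cast
      calc ((j : ℝ) + 1) * (Real.pi / n) ≤ n * (Real.pi / n) := by gcongr
        _ = Real.pi := by field_simp
    have hstart : 0 ≤ (j : ℝ) * (Real.pi / n) := by positivity
    have hmid1 : (j : ℝ) * (Real.pi / n) ≤ (2 * j + 1) / (2 * n) * Real.pi := by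
      rw [show (2 * j + 1) / (2 * n) * Real.pi = (j : ℝ) * (Real.pi / n) + Real.pi / n / 2 by
        field_simp]
      have : 0 < Real.pi / n := by positivity
      linarith
    have hmid2 : (2 * j + 1) / (2 * n) * Real.pi ≤ ((j + 1 : ℕ) : ℝ) * (Real.pi / n) := by
      rw [show (2 * j + 1) / (2 * n) * Real.pi =
        ((j + 1 : ℕ) : ℝ) * (Real.pi / n) - Real.pi / n / 2 by push_cast; field_simp; ring]
      have : 0 < Real.pi / n := by positivity
      linarith
    have := intervalIntegral.norm_integral_le_of_norm_le_const (a := (j : ℝ) * (Real.pi / n))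
      (b := ((j + 1 : ℕ) : ℝ) * (Real.pi / n)) (C := ε / (2 * Real.pi))
      (f := fun t => φ ((2 * j + 1) / (2 * n) * Real.pi) - φ t) ?_
    · rwa [hlen, abs_of_pos (by positivity : 0 < Real.pi / n)] at this
    intro t ht
    rw [uIoc_of_le hle] at ht
    refine (hδ' _ ⟨hstart.trans hmid1, hmid2.trans hend⟩ t
      ⟨hstart.trans ht.1.le, ht.2.trans hend⟩ ?_).le
    rw [Real.dist_eq, abs_lt]
    constructor <;> linarith [ht.1, ht.2]
  rw [hsum, hint, Real.dist_eq, Finset.mul_sum, ← Finset.sum_sub_distrib, ← Real.norm_eq_abs]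
  calc _ ≤ ∑ j ∈ Finset.range n, ε / (2 * Real.pi) * (Real.pi / n) := norm_sum_le_of_le _ hpiece
    _ = ε / 2 := by
      rw [Finset.sum_const, Finset.card_range, nsmul_eq_mul]
      field_simp
    _ < ε := by linarith

/-- The exponent of the Laplace transform of the interference: the mean of `quadIntegrand` over the
uniformly distributed beam direction, times the intensity of the line-of-sight disc. -/
noncomputable def interferenceExponent (p : Params) (s : ℝ) : ℝ :=
  Real.pi * p.density * p.RL ^ 2 * ((2 * (p.spacing / p.wavelength))⁻¹ *
    ∫ x in (-(p.spacing / p.wavelength))..(p.spacing / p.wavelength), quadIntegrand p s x)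

/-- Gauss-Chebyshev quadrature with weight `√(1 - x²)` at the nodes `cos θᵢ` is the midpoint rule
after the substitution `x = cos θ`. -/
theorem tendsto_laplaceClosed (p : Params) {s : ℝ} (hs : 0 ≤ s) :
    Tendsto (fun n => laplaceClosed p n s) atTop (𝓝 (Real.exp (-interferenceExponent p s))) := by
  set c := p.spacing / p.wavelength with hc
  have hc0 : 0 < c := div_pos p.spacing_pos p.wavelength_pos
  have hQ := continuous_quadIntegrand p hs
  have hsub : ∫ t in (0)..Real.pi, quadIntegrand p s (Real.cos t * c) * √(1 - Real.cos t ^ 2) =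
      c⁻¹ * ∫ x in (-c)..c, quadIntegrand p s x := by
    have h1 := intervalIntegral.integral_comp_mul_deriv (a := 0) (b := Real.pi)
      (f := fun t => Real.cos t * c) (f' := fun t => -Real.sin t * c) (g := quadIntegrand p s)
      (fun t _ => (Real.hasDerivAt_cos t).mul_const c) (by fun_prop) hQ
    simp only [Real.cos_zero, Real.cos_pi, one_mul, neg_mul, mul_neg,
      intervalIntegral.integral_neg] at h1
    rw [intervalIntegral.integral_symm (-c) c, neg_inj] at h1
    rw [← h1, ← intervalIntegral.integral_const_mul]
    refine intervalIntegral.integral_congr fun t ht => ?_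
    rw [uIcc_of_le Real.pi_pos.le] at ht
    have : √(1 - Real.cos t ^ 2) = Real.sin t := by
      rw [← Real.abs_sin_eq_sqrt_one_sub_cos_sq, abs_of_nonneg (Real.sin_nonneg_of_mem_Icc ht)]
    simp only [this, Function.comp]
    field_simp
  have h := (tendsto_midpoint_sum
    (φ := fun t => quadIntegrand p s (Real.cos t * c) * √(1 - Real.cos t ^ 2)) (by fun_prop))
      |>.const_mul (Real.pi * p.density * p.RL ^ 2 / 2)
  rw [hsub] at h
  refine (Real.continuous_exp.tendsto _).comp ?_
  convert h.neg using 2 with n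
  · congr 1
    simp only [chebNode, hc, mul_div_assoc]
    ring
  · rw [interferenceExponent, mul_inv]
    ring

theorem laplaceClosed_pos (p : Params) (n : ℕ) (s : ℝ) : 0 < laplaceClosed p n s := Real.exp_pos _

theorem laplaceClosed_le_one (p : Params) (n : ℕ) {s : ℝ} (hs : 0 ≤ s) :
    laplaceClosed p n s ≤ 1 := by
  rw [laplaceClosed, Real.exp_le_one_iff, neg_nonpos]
  refine mul_nonneg ?_ (Finset.sum_nonneg fun i _ =>
    mul_nonneg (quadIntegrand_nonneg p hs _) (Real.sqrt_nonneg _))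
  have := p.density_pos
  positivity

theorem continuousOn_laplaceClosed (p : Params) (n : ℕ) :
    ContinuousOn (laplaceClosed p n) (Ici 0) := by
  have : ∀ x, ContinuousOn (fun s => quadIntegrand p s x) (Ici 0) := fun x =>
    ((continuous_radialExponent_max p).comp
      (by fun_prop : Continuous fun s : ℝ => s * fejer p.M x)).continuousOn.congr
        fun s hs => quadIntegrand_eq_max p hs x
  unfold laplaceClosed
  fun_prop

theorem continuousOn_interferenceExponent (p : Params) :
    ContinuousOn (interferenceExponent p) (Ici 0) := by
  have hF := continuous_fejer p.M_pos
  have h := intervalIntegral.continuous_parametric_intervalIntegral_of_continuous'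
    (f := fun s x => radialExponent p (max (s * fejer p.M x) 0)) (μ := volume)
    ((continuous_radialExponent_max p).comp (by fun_prop : Continuous fun z : ℝ × ℝ =>
      z.1 * fejer p.M z.2)) (-(p.spacing / p.wavelength)) (p.spacing / p.wavelength)
  refine ContinuousOn.congr (f := fun s => Real.pi * p.density * p.RL ^ 2 *
    ((2 * (p.spacing / p.wavelength))⁻¹ *
      ∫ x in (-(p.spacing / p.wavelength))..(p.spacing / p.wavelength),
        radialExponent p (max (s * fejer p.M x) 0)))
    (continuous_const.mul (continuous_const.mul h)).continuousOn fun s hs => ?_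
  simp only [interferenceExponent, quadIntegrand_eq_max p hs]

theorem interferenceExponent_zero (p : Params) : interferenceExponent p 0 = 0 := by
  simp [interferenceExponent, quadIntegrand]

/-! ### The Laplace functional of a Poisson point process -/

/-- The function `exp (-t)` on `[0, ∞]`, with value `0` at `∞`. With it, Laplace transforms of
infinite sums need no finiteness assumption. -/
noncomputable def negExp (t : ℝ≥0∞) : ℝ≥0∞ := EReal.exp (-(t : EReal))

theorem negExp_zero : negExp 0 = 1 := by simp [negExp]

theorem negExp_top : negExp ∞ = 0 := by simp [negExp]

theorem negExp_ofReal {x : ℝ} (hx : 0 ≤ x) :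
    negExp (ENNReal.ofReal x) = ENNReal.ofReal (Real.exp (-x)) := by
  rw [negExp, EReal.coe_ennreal_ofReal, max_eq_left hx, ← EReal.coe_neg, EReal.exp_coe]

theorem continuous_negExp : Continuous negExp :=
  EReal.expHomeomorph.continuous.comp (continuous_neg.comp continuous_coe_ennreal_ereal)

theorem negExp_antitone : Antitone negExp := by
  intro a b h
  exact EReal.exp_monotone (EReal.neg_le_neg_iff.2 (EReal.coe_ennreal_le_coe_ennreal_iff.2 h))

theorem negExp_le_one (t : ℝ≥0∞) : negExp t ≤ 1 := negExp_zero ▸ negExp_antitone zero_le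

theorem negExp_ne_top (t : ℝ≥0∞) : negExp t ≠ ∞ :=
  ne_top_of_le_ne_top ENNReal.one_ne_top (negExp_le_one t)

theorem negExp_eq_ofReal {t : ℝ≥0∞} (ht : t ≠ ∞) :
    negExp t = ENNReal.ofReal (Real.exp (-t.toReal)) := by
  conv_lhs => rw [← ENNReal.ofReal_toReal ht]
  exact negExp_ofReal ENNReal.toReal_nonneg

theorem negExp_add (a b : ℝ≥0∞) : negExp (a + b) = negExp a * negExp b := by
  rcases eq_or_ne a ∞ with rfl | ha
  · simp [negExp_top]
  rcases eq_or_ne b ∞ with rfl | hb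
  · simp [negExp_top]
  rw [negExp_eq_ofReal ha, negExp_eq_ofReal hb, negExp_eq_ofReal (ENNReal.add_ne_top.2 ⟨ha, hb⟩),
    ← ENNReal.ofReal_mul (Real.exp_pos _).le, ← Real.exp_add, ENNReal.toReal_add ha hb, neg_add]

theorem negExp_sum {ι : Type*} (s : Finset ι) (f : ι → ℝ≥0∞) :
    negExp (∑ i ∈ s, f i) = ∏ i ∈ s, negExp (f i) := by
  induction s using Finset.cons_induction with
  | empty => simp [negExp_zero]
  | cons a s ha ih => rw [Finset.sum_cons, Finset.prod_cons, negExp_add, ih]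

theorem negExp_mul_natCast (c : ℝ≥0∞) (k : ℕ) : negExp (c * k) = negExp c ^ k := by
  induction k with
  | zero => simp [negExp_zero]
  | succ k ih => rw [Nat.cast_succ, mul_add, mul_one, negExp_add, ih, pow_succ]

theorem tendsto_prod_negExp (f : ℕ → ℝ≥0∞) :
    Tendsto (fun n => ∏ i ∈ Finset.range n, negExp (f i)) atTop (𝓝 (negExp (∑' i, f i))) := by
  simp only [← negExp_sum]
  exact (continuous_negExp.tendsto _).comp ENNReal.summable.hasSum.tendsto_sum_nat

/-- The Laplace transform of the Poisson distribution. -/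
theorem lintegral_negExp_poissonMeasure (r : ℝ≥0) (c : ℝ≥0∞) :
    ∫⁻ k, negExp (c * k) ∂((poissonMeasure r).map (Nat.cast : ℕ → ℝ≥0∞)) =
      negExp (r * (1 - negExp c)) := by
  have hq := negExp_le_one c
  set q := (negExp c).toReal with hqdef
  have hq0 : 0 ≤ q := ENNReal.toReal_nonneg
  have hcq : negExp c = ENNReal.ofReal q := (ENNReal.ofReal_toReal (negExp_ne_top c)).symm
  have hq1 : q ≤ 1 := ENNReal.toReal_le_of_le_ofReal zero_le_one (by simpa using hq)
  rw [lintegral_map (f := fun k => negExp (c * k))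
    (continuous_negExp.measurable.comp (measurable_const_mul c)) (by fun_prop)]
  simp only [negExp_mul_natCast, hcq]
  rw [poissonMeasure, lintegral_sum_measure]
  simp only [lintegral_smul_measure, lintegral_dirac, smul_eq_mul]
  have h1 : (r : ℝ≥0∞) * (1 - ENNReal.ofReal q) = ENNReal.ofReal (r * (1 - q)) := by
    rw [ENNReal.ofReal_mul r.coe_nonneg, ENNReal.ofReal_sub _ hq0, ENNReal.ofReal_one,
      ENNReal.ofReal_coe_nnreal]
  rw [h1, negExp_ofReal (mul_nonneg r.coe_nonneg (by linarith))]
  have h2 := (hasSum_one_poissonMeasure (r * q.toNNReal)).mul_left (Real.exp (-(r * (1 - q))))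
  rw [mul_one] at h2
  rw [← h2.tsum_eq, ENNReal.ofReal_tsum_of_nonneg (fun n => by positivity) h2.summable]
  congr 1
  ext n
  rw [← ENNReal.ofReal_pow hq0, ← ENNReal.ofReal_mul (by positivity)]
  congr 1
  push_cast
  rw [Real.coe_toNNReal _ hq0, mul_pow, div_mul_eq_mul_div, mul_div_assoc', ← mul_assoc,
    ← Real.exp_add]
  ring_nf

section PoissonProcess

variable {Ω E : Type*} [MeasurableSpace Ω] [MeasurableSpace E]

theorem measurable_pointCount {Y : ℕ → Ω → E} (hY : ∀ n, Measurable (Y n)) {B : Set E}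
    (hB : MeasurableSet B) : Measurable (pointCount Y B) := by
  unfold pointCount
  simp only [Measure.sum_apply _ hB, Measure.dirac_apply' _ hB]
  exact Measurable.tsum fun n => (measurable_one.indicator hB).comp (hY n)

theorem tsum_eq_lintegral_sum_dirac {φ : E → ℝ≥0∞} (hφ : Measurable φ) (y : ℕ → E) :
    ∑' n, φ (y n) = ∫⁻ x, φ x ∂(Measure.sum fun n => Measure.dirac (y n)) := by
  rw [lintegral_sum_measure]
  simp only [lintegral_dirac' _ hφ]

/-- The Laplace functional at a simple function that vanishes off a set of finite intensity: the
numbers of points in its level sets are independent and Poisson distributed. -/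
theorem lintegral_negExp_simpleFunc {Y : ℕ → Ω → E} {ν : Measure E} {μ : Measure Ω}
    (h : IsPoissonProcess Y ν μ) (f : SimpleFunc E ℝ≥0∞)
    (hf : ∀ c, c ≠ 0 → ν (f ⁻¹' {c}) ≠ ∞) :
    ∫⁻ ω, negExp (∑' n, f (Y n ω)) ∂μ = negExp (∫⁻ y, (1 - negExp (f y)) ∂ν) := by
  classical
  set s := f.range.filter (· ≠ 0)
  set e : Fin s.card ≃ s := s.equivFin.symm
  have hsum : ∀ (m : Measure E) (g : ℝ≥0∞ → ℝ≥0∞), g 0 = 0 →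
      ∫⁻ y, g (f y) ∂m = ∑ i, g (e i) * m (f ⁻¹' {(e i : ℝ≥0∞)}) := by
    intro m g hg
    have h1 : ∫⁻ y, g (f y) ∂m = ∑ x ∈ f.range, g x * m (f ⁻¹' {x}) := by
      rw [← SimpleFunc.map_lintegral, ← SimpleFunc.lintegral_eq_lintegral]
      rfl
    rw [h1, e.sum_comp (fun c : s => g c * m (f ⁻¹' {(c : ℝ≥0∞)})),
      Finset.sum_coe_sort s (fun c => g c * m (f ⁻¹' {c}))]
    refine (Finset.sum_filter_of_ne fun x _ hx => ?_).symm
    rintro rfl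
    exact hx (by rw [hg, zero_mul])
  have hB : ∀ i, MeasurableSet (f ⁻¹' {(e i : ℝ≥0∞)}) := fun i => f.measurableSet_preimage _
  have hdisj : Pairwise fun i j => Disjoint (f ⁻¹' {(e i : ℝ≥0∞)}) (f ⁻¹' {(e j : ℝ≥0∞)}) := by
    intro i j hij
    refine Disjoint.preimage _ (disjoint_singleton.2 fun h => hij ?_)
    exact e.injective (Subtype.ext h)
  have hne : ∀ i, (e i : ℝ≥0∞) ≠ 0 := fun i => (Finset.mem_filter.1 (e i).2).2
  have h1 : ∀ ω, negExp (∑' n, f (Y n ω)) =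
      ∏ i, negExp (e i * pointCount Y (f ⁻¹' {(e i : ℝ≥0∞)}) ω) := by
    intro ω
    have := hsum (Measure.sum fun n => Measure.dirac (Y n ω)) id rfl
    simp only [id_eq] at this
    rw [tsum_eq_lintegral_sum_dirac f.measurable, this, negExp_sum]
    rfl
  have hmeas : ∀ i, Measurable fun t : ℝ≥0∞ => negExp (e i * t) := fun i =>
    continuous_negExp.measurable.comp (measurable_const_mul _)
  have hind := (h.indep_count s.card (fun i => f ⁻¹' {(e i : ℝ≥0∞)}) hB hdisj).comp
    (fun i t => negExp (e i * t)) hmeas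
  simp only [h1]
  rw [hsum ν (fun c => 1 - negExp c) (by simp [negExp_zero]), negExp_sum]
  refine (lintegral_prod_eq_prod_lintegral_of_indepFun Finset.univ _ hind
    fun i => (hmeas i).comp (measurable_pointCount h.measurable (hB i))).trans ?_
  refine Finset.prod_congr rfl fun i _ => ?_
  have hfin := hf _ (hne i)
  refine ((h.hasLaw_count _ (hB i) hfin).lintegral_comp (hmeas i).aemeasurable).trans ?_
  rw [lintegral_negExp_poissonMeasure, ENNReal.coe_toNNReal hfin, mul_comm]

/-- The **Laplace functional** of a Poisson point process. -/
theorem lintegral_negExp_poissonProcess {Y : ℕ → Ω → E} {ν : Measure E} [SigmaFinite ν]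
    {μ : Measure Ω} [IsFiniteMeasure μ] (h : IsPoissonProcess Y ν μ) {φ : E → ℝ≥0∞}
    (hφ : Measurable φ) :
    ∫⁻ ω, negExp (∑' n, φ (Y n ω)) ∂μ = negExp (∫⁻ y, (1 - negExp (φ y)) ∂ν) := by
  -- After the restriction to a spanning set, the level sets have finite intensity.
  set f : ℕ → SimpleFunc E ℝ≥0∞ := fun k => (SimpleFunc.eapprox φ k).restrict (spanningSets ν k)
  have hfapp : ∀ k x, f k x = (spanningSets ν k).indicator (SimpleFunc.eapprox φ k) x := fun k x =>
    SimpleFunc.restrict_apply _ (measurableSet_spanningSets ν k) x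
  have hmono : ∀ x, Monotone fun k => f k x := by
    intro x j k hjk
    simp only [hfapp]
    by_cases hx : x ∈ spanningSets ν j
    · rw [indicator_of_mem hx, indicator_of_mem (monotone_spanningSets ν hjk hx)]
      exact SimpleFunc.monotone_eapprox φ hjk x
    · rw [indicator_of_notMem hx]
      exact zero_le
  have hlim : ∀ x, Tendsto (fun k => f k x) atTop (𝓝 (φ x)) := by
    intro x
    refine (SimpleFunc.tendsto_eapprox hφ x).congr' ?_
    filter_upwards [eventually_ge_atTop (spanningSetsIndex ν x)] with k hk
    rw [hfapp, indicator_of_mem]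
    exact mem_spanningSets_of_index_le ν x hk
  have hsimple : ∀ k, ∫⁻ ω, negExp (∑' n, f k (Y n ω)) ∂μ =
      negExp (∫⁻ y, (1 - negExp (f k y)) ∂ν) := by
    intro k
    refine lintegral_negExp_simpleFunc h (f k) fun c hc => ?_
    refine ne_top_of_le_ne_top (measure_spanningSets_lt_top ν k).ne (measure_mono fun x hx => ?_)
    by_contra hx'
    have : f k x = 0 := by rw [hfapp, indicator_of_notMem hx']
    exact hc (by rw [← (hx : f k x = c), this])
  have hleft : Tendsto (fun k => ∫⁻ ω, negExp (∑' n, f k (Y n ω)) ∂μ) atTop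
      (𝓝 (∫⁻ ω, negExp (∑' n, φ (Y n ω)) ∂μ)) := by
    refine tendsto_lintegral_of_dominated_convergence (fun _ => 1) (fun k => ?_) (fun k => ?_)
      (by simp) (ae_of_all _ fun ω => ?_)
    · exact continuous_negExp.measurable.comp
        (Measurable.tsum fun n => (f k).measurable.comp (h.measurable n))
    · exact ae_of_all _ fun ω => negExp_le_one _
    · refine (continuous_negExp.tendsto _).comp ?_
      simp only [tsum_eq_lintegral_sum_dirac hφ, tsum_eq_lintegral_sum_dirac (f _).measurable]
      exact lintegral_tendsto_of_tendsto_of_monotone (fun k => (f k).measurable.aemeasurable)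
        (ae_of_all _ hmono) (ae_of_all _ hlim)
  have hright : Tendsto (fun k => negExp (∫⁻ y, (1 - negExp (f k y)) ∂ν)) atTop
      (𝓝 (negExp (∫⁻ y, (1 - negExp (φ y)) ∂ν))) := by
    refine (continuous_negExp.tendsto _).comp ?_
    refine lintegral_tendsto_of_tendsto_of_monotone (fun k => ?_) (ae_of_all _ fun x j k hjk => ?_)
      (ae_of_all _ fun x => ?_)
    · exact (measurable_const.sub (continuous_negExp.measurable.comp (f k).measurable)).aemeasurable
    · exact tsub_le_tsub_left (negExp_antitone (hmono x hjk)) 1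
    · exact ENNReal.Tendsto.sub tendsto_const_nhds ((continuous_negExp.tendsto _).comp (hlim x))
        (Or.inl ENNReal.one_ne_top)
  simp only [hsimple] at hleft
  exact tendsto_nhds_unique hleft hright

end PoissonProcess

/-! ### The Laplace transform of the interference -/

/-- Fubini's theorem for independent random variables. -/
theorem lintegral_comp_prod_of_indepFun {Ω α β : Type*} [MeasurableSpace Ω] [MeasurableSpace α]
    [MeasurableSpace β] {μ : Measure Ω} [IsProbabilityMeasure μ] {X : Ω → α} {Z : Ω → β}
    (hX : Measurable X) (hZ : Measurable Z) (h : IndepFun X Z μ) {f : α × β → ℝ≥0∞}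
    (hf : Measurable f) :
    ∫⁻ ω, f (X ω, Z ω) ∂μ = ∫⁻ ω, ∫⁻ ω', f (X ω, Z ω') ∂μ ∂μ := by
  have hP := Measure.isProbabilityMeasure_map (μ := μ) hZ.aemeasurable
  rw [← lintegral_map hf (hX.prodMk hZ),
    h.map_prod_eq_prod_map_map hX.aemeasurable hZ.aemeasurable, lintegral_prod _ hf.aemeasurable,
    lintegral_map hf.lintegral_prod_right' hX]
  congr 1
  ext ω
  exact lintegral_map (hf.comp measurable_prodMk_left) hZ

/-- The Laplace transform of the squared Nakagami amplitude. -/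
theorem lintegral_negExp_nakagamiMeasure {N : ℕ} (hN : 0 < N) {t : ℝ} (ht : 0 ≤ t) :
    ∫⁻ a, negExp (ENNReal.ofReal (t * a ^ 2)) ∂nakagamiMeasure N =
      ENNReal.ofReal ((1 + t / N) ^ N)⁻¹ := by
  have hN' : (0 : ℝ) < N := by exact_mod_cast hN
  have hNt : (0 : ℝ) < N + t := by linarith
  have hm : Measurable fun a : ℝ => negExp (ENNReal.ofReal (t * a ^ 2)) :=
    continuous_negExp.measurable.comp (by fun_prop)
  have hm2 : Measurable fun a : ℝ => negExp (ENNReal.ofReal (t * √a ^ 2)) :=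
    hm.comp (g := fun a : ℝ => negExp (ENNReal.ofReal (t * a ^ 2))) (f := Real.sqrt) (by fun_prop)
  have hpdf : ∀ r : ℝ, Measurable (gammaPDF N r) := fun r =>
    (measurable_gammaPDFReal N r).ennreal_ofReal
  rw [nakagamiMeasure, lintegral_map hm (by fun_prop), gammaMeasure,
    lintegral_withDensity_eq_lintegral_mul _ (hpdf N) hm2]
  have hpt : ∀ x, (gammaPDF N N * fun a => negExp (ENNReal.ofReal (t * √a ^ 2))) x =
      ENNReal.ofReal ((1 + t / N) ^ N)⁻¹ * gammaPDF N (N + t) x := by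
    intro x
    rw [Pi.mul_apply]
    rcases lt_or_ge x 0 with hx | hx
    · rw [gammaPDF_of_neg hx, gammaPDF_of_neg hx, zero_mul, mul_zero]
    have hG : 0 < Real.Gamma N := Real.Gamma_pos_of_pos hN'
    rw [gammaPDF_of_nonneg hx, gammaPDF_of_nonneg hx, Real.sq_sqrt hx,
      negExp_ofReal (mul_nonneg ht hx), ← ENNReal.ofReal_mul (by positivity),
      ← ENNReal.ofReal_mul (by positivity)]
    congr 1
    have e : Real.exp (-((N + t) * x)) = Real.exp (-(N * x)) * Real.exp (-(t * x)) := by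
      rw [← Real.exp_add]; ring_nf
    have e2 : (1 + t / N) ^ N = (N + t) ^ N / (N : ℝ) ^ N := by
      rw [← div_pow]; congr 1; field_simp
    rw [e, e2, Real.rpow_natCast, Real.rpow_natCast]
    field_simp
  simp only [hpt]
  rw [lintegral_const_mul _ (hpdf _), lintegral_gammaPDF_eq_one hN' hNt, mul_one]

/-- The function `-log t` on `[0, 1]`, with values in `[0, ∞]`. It turns a product over the points
of a point process into `negExp` of a sum, to which the Laplace functional applies. -/
noncomputable def negLog (t : ℝ≥0∞) : ℝ≥0∞ := (-(ENNReal.log t)).toENNReal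

theorem negExp_negLog {t : ℝ≥0∞} (ht : t ≤ 1) : negExp (negLog t) = t := by
  have h : 0 ≤ -(ENNReal.log t) := by
    have := ENNReal.log_monotone ht
    rw [ENNReal.log_one] at this
    simpa using EReal.neg_le_neg_iff.2 this
  rw [negExp, negLog, EReal.coe_toENNReal h, neg_neg, ENNReal.exp_log]

theorem measurable_negLog : Measurable negLog :=
  (continuous_neg.measurable.comp ENNReal.measurable_log).ereal_toENNReal

/-- The interference received at `u` from base stations at `y n` with marks `m n`, which consist of
the fading amplitudes and the beam direction. -/
noncomputable def interferenceAt (p : Params) (u : Plane) (y : ℕ → Plane)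
    (m : ℕ → (Link → ℝ) × ℝ) : ℝ≥0∞ :=
  ∑' n, ENNReal.ofReal
    (p.M * (m n).1 (p.link ‖u + y n‖) ^ 2 * fejer p.M (m n).2 * p.pathLoss ‖u + y n‖)

theorem measurable_interferenceAt (p : Params) :
    Measurable fun z : Plane × (ℕ → Plane) × (ℕ → (Link → ℝ) × ℝ) =>
      interferenceAt p z.1 z.2.1 z.2.2 := by
  refine Measurable.tsum fun n => Measurable.ennreal_ofReal ?_
  have hr : Measurable fun z : Plane × (ℕ → Plane) × (ℕ → (Link → ℝ) × ℝ) => ‖z.1 + z.2.1 n‖ := by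
    fun_prop
  have hg : Measurable fun z : Plane × (ℕ → Plane) × (ℕ → (Link → ℝ) × ℝ) =>
      (z.2.2 n).1 (p.link ‖z.1 + z.2.1 n‖) :=
    measurable_link_rec p hr (f := fun κ z => (z.2.2 n).1 κ) fun κ => by fun_prop
  have hF := (continuous_fejer p.M_pos).measurable
  exact ((measurable_const.mul (hg.pow_const 2)).mul (hF.comp (by fun_prop))).mul
    ((measurable_pathLoss p).comp hr)

theorem isProbabilityMeasure_angleLaw (p : Params) : IsProbabilityMeasure (angleLaw p) := by
  have hc : 0 < p.spacing / p.wavelength := div_pos p.spacing_pos p.wavelength_pos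
  refine cond_isProbabilityMeasure_of_finite ?_ ?_
  · simp only [Real.volume_Icc, ne_eq, ENNReal.ofReal_eq_zero, not_le]
    linarith
  · simp

/-- The Laplace transform at `s` of the power received from an interferer at distance `r`: the mean
of `linkLaplace` over the beam direction. -/
noncomputable def meanLinkLaplace (p : Params) (s r : ℝ) : ℝ≥0∞ :=
  ∫⁻ x, ENNReal.ofReal (linkLaplace p (s * fejer p.M x) r) ∂angleLaw p

theorem measurable_linkLaplace_fejer (p : Params) (s : ℝ) :
    Measurable fun z : ℝ × ℝ => linkLaplace p (s * fejer p.M z.2) z.1 := by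
  have hF := (continuous_fejer p.M_pos).measurable
  exact (measurable_linkLaplace p).comp
    (by fun_prop : Measurable fun z : ℝ × ℝ => (s * fejer p.M z.2, z.1))

theorem measurable_meanLinkLaplace (p : Params) (s : ℝ) : Measurable (meanLinkLaplace p s) := by
  have := isProbabilityMeasure_angleLaw p
  exact (measurable_linkLaplace_fejer p s).ennreal_ofReal.lintegral_prod_right'

theorem meanLinkLaplace_le_one (p : Params) {s r : ℝ} (hs : 0 ≤ s) (hr : 0 ≤ r) :
    meanLinkLaplace p s r ≤ 1 := by
  have := isProbabilityMeasure_angleLaw p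
  calc meanLinkLaplace p s r ≤ ∫⁻ _, 1 ∂angleLaw p := by
        refine lintegral_mono fun x => ?_
        rw [ENNReal.ofReal_le_one]
        exact linkLaplace_le_one p (mul_nonneg hs (fejer_nonneg _ _)) hr
    _ = 1 := by simp

theorem integral_angleLaw (p : Params) (f : ℝ → ℝ) :
    ∫ x, f x ∂angleLaw p = (2 * (p.spacing / p.wavelength))⁻¹ *
      ∫ x in (-(p.spacing / p.wavelength))..(p.spacing / p.wavelength), f x := by
  have hc : 0 < p.spacing / p.wavelength := div_pos p.spacing_pos p.wavelength_pos
  rw [angleLaw, ProbabilityTheory.cond, integral_smul_measure,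
    intervalIntegral.integral_of_le (by linarith), ← integral_Icc_eq_integral_Ioc, Real.volume_Icc,
    ENNReal.toReal_inv,
    ENNReal.toReal_ofReal (by linarith), smul_eq_mul]
  ring_nf

theorem integrable_angleLaw (p : Params) {f : ℝ → ℝ} (hf : Continuous f) :
    Integrable f (angleLaw p) := by
  have hc : 0 < p.spacing / p.wavelength := div_pos p.spacing_pos p.wavelength_pos
  refine Integrable.smul_measure (hf.integrableOn_Icc) ?_
  simp only [Real.volume_Icc, ne_eq, ENNReal.inv_eq_top, ENNReal.ofReal_eq_zero, not_le]
  linarith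

/-- The exponent in the Laplace functional of the interfering base stations. -/
theorem lintegral_one_sub_meanLinkLaplace (p : Params) {s : ℝ} (hs : 0 ≤ s) :
    ENNReal.ofReal p.density * ∫⁻ z : Plane, (1 - meanLinkLaplace p s ‖z‖) =
      ENNReal.ofReal (interferenceExponent p s) := by
  have hP := isProbabilityMeasure_angleLaw p
  have hy : ∀ x, 0 ≤ s * fejer p.M x := fun x => mul_nonneg hs (fejer_nonneg _ _)
  have hm := measurable_linkLaplace_fejer p s
  have h1 : ∀ z : Plane, 1 - meanLinkLaplace p s ‖z‖ =
      ∫⁻ x, ENNReal.ofReal (1 - linkLaplace p (s * fejer p.M x) ‖z‖) ∂angleLaw p := by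
    intro z
    have hm' : Measurable fun x => linkLaplace p (s * fejer p.M x) ‖z‖ := by
      have := hm.comp (by fun_prop : Measurable fun x : ℝ => (‖z‖, x))
      exact this
    have hle : ∀ x, linkLaplace p (s * fejer p.M x) ‖z‖ ≤ 1 := fun x =>
      linkLaplace_le_one p (hy x) (norm_nonneg z)
    have h0 : ∀ x, 0 ≤ linkLaplace p (s * fejer p.M x) ‖z‖ := fun x =>
      (linkLaplace_pos p (hy x) (norm_nonneg z)).le
    have hone : ∫⁻ _, (1 : ℝ≥0∞) ∂angleLaw p = 1 := by simp
    have hfin : meanLinkLaplace p s ‖z‖ ≠ ∞ :=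
      ne_top_of_le_ne_top ENNReal.one_ne_top (meanLinkLaplace_le_one p hs (norm_nonneg z))
    have hsub := lintegral_sub (μ := angleLaw p) (f := fun _ => 1) hm'.ennreal_ofReal hfin
      (ae_of_all _ fun x => ENNReal.ofReal_le_one.2 (hle x))
    rw [hone] at hsub
    rw [meanLinkLaplace, ← hsub]
    refine lintegral_congr fun x => ?_
    rw [ENNReal.ofReal_sub _ (h0 x), ENNReal.ofReal_one]
  simp only [h1]
  rw [lintegral_lintegral_swap]
  swap
  · refine Measurable.aemeasurable ?_
    have := hm.comp (by fun_prop : Measurable fun z : Plane × ℝ => (‖z.1‖, z.2))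
    exact (this.const_sub 1).ennreal_ofReal
  have h2 : ∀ x, ∫⁻ z : Plane, ENNReal.ofReal (1 - linkLaplace p (s * fejer p.M x) ‖z‖) =
      ENNReal.ofReal (Real.pi * p.RL ^ 2 * quadIntegrand p s x) := by
    intro x
    obtain ⟨i, h⟩ := integral_plane_linkLaplace p (hy x)
    rw [quadIntegrand_eq, ← h, ofReal_integral_eq_lintegral_ofReal i]
    exact ae_of_all _ fun z => sub_nonneg.2 (linkLaplace_le_one p (hy x) (norm_nonneg z))
  have hc : Continuous fun x => Real.pi * p.RL ^ 2 * quadIntegrand p s x :=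
    continuous_const.mul (continuous_quadIntegrand p hs)
  have hn : ∀ x, 0 ≤ Real.pi * p.RL ^ 2 * quadIntegrand p s x := fun x =>
    mul_nonneg (by positivity) (quadIntegrand_nonneg p hs x)
  simp only [h2]
  rw [← ofReal_integral_eq_lintegral_ofReal (integrable_angleLaw p hc) (ae_of_all _ hn),
    ← ENNReal.ofReal_mul p.density_pos.le, integral_const_mul, integral_angleLaw]
  congr 1
  rw [interferenceExponent]
  ring

section Network

variable {p : Params} {Ω : Type*} [MeasurableSpace Ω] {μ : Measure Ω}
  {user : Fin (2 * p.K) → Ω → Plane} {near : Ω → Fin (2 * p.K)} {g : Link → Ω → ℝ}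
  {Y : ℕ → Ω → Plane} {G : ℕ → Link → Ω → ℝ} {ϑ : ℕ → Ω → ℝ}

/-- The Laplace transform of the power received from one interferer at distance `r`. -/
theorem lintegral_negExp_mark [IsProbabilityMeasure μ]
    (hnet : IsNetwork p μ user near g Y G ϑ) {s r : ℝ} (hs : 0 ≤ s)
    (hr : 0 ≤ r) (n : ℕ) :
    ∫⁻ ω, negExp (ENNReal.ofReal s * ENNReal.ofReal
      (p.M * G n (p.link r) ω ^ 2 * fejer p.M (ϑ n ω) * p.pathLoss r)) ∂μ =
      meanLinkLaplace p s r := by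
  have hF := (continuous_fejer p.M_pos).measurable
  have hind : IndepFun (ϑ n) (G n (p.link r)) μ :=
    ((hnet.indep_G_ϑ n).comp (measurable_pi_apply (p.link r)) measurable_id).symm
  have hL := pathLoss_nonneg p hr
  set f : ℝ × ℝ → ℝ≥0∞ := fun z => negExp (ENNReal.ofReal
    (s * fejer p.M z.1 * (p.M * p.pathLoss r) * z.2 ^ 2)) with hfdef
  have hf : Measurable f := continuous_negExp.measurable.comp (by fun_prop)
  have h1 : ∀ ω, negExp (ENNReal.ofReal s * ENNReal.ofReal
      (p.M * G n (p.link r) ω ^ 2 * fejer p.M (ϑ n ω) * p.pathLoss r)) =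
      f (ϑ n ω, G n (p.link r) ω) := by
    intro ω
    rw [hfdef, ← ENNReal.ofReal_mul hs]
    congr 2
    ring
  simp only [h1]
  rw [lintegral_comp_prod_of_indepFun (hnet.measurable_ϑ n) (hnet.measurable_G n _) hind hf]
  have h2 : ∀ x, ∫⁻ ω', f (x, G n (p.link r) ω') ∂μ =
      ENNReal.ofReal (linkLaplace p (s * fejer p.M x) r) := by
    intro x
    have hx := fejer_nonneg p.M x
    rw [(hnet.hasLaw_G n (p.link r)).lintegral_comp (f := fun a => f (x, a))
      (hf.comp measurable_prodMk_left).aemeasurable]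
    have := lintegral_negExp_nakagamiMeasure (p.N_pos (p.link r))
      (t := s * fejer p.M x * (p.M * p.pathLoss r)) (by positivity)
    exact this
  simp only [h2]
  exact (hnet.hasLaw_ϑ n).lintegral_comp (f := fun x =>
    ENNReal.ofReal (linkLaplace p (s * fejer p.M x) r))
    ((measurable_linkLaplace_fejer p s).comp
      (measurable_prodMk_left (x := r))).ennreal_ofReal.aemeasurable

theorem measurable_marks (hnet : IsNetwork p μ user near g Y G ϑ) (n : ℕ) :
    Measurable fun ω => ((fun κ => G n κ ω : Link → ℝ), ϑ n ω) :=
  (measurable_pi_lambda _ fun κ => hnet.measurable_G n κ).prodMk (hnet.measurable_ϑ n)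

/-- The Laplace transform of the interference from base stations at given positions is the product
of the contributions of the interferers, whose marks are independent. -/
theorem lintegral_negExp_marks [IsProbabilityMeasure μ]
    (hnet : IsNetwork p μ user near g Y G ϑ) {s : ℝ} (hs : 0 ≤ s)
    (u : Plane) (y : ℕ → Plane) :
    ∫⁻ ω, negExp (ENNReal.ofReal s *
      interferenceAt p u y (fun n => ((fun κ => G n κ ω), ϑ n ω))) ∂μ =
      negExp (∑' n, negLog (meanLinkLaplace p s ‖u + y n‖)) := by
  have hF := (continuous_fejer p.M_pos).measurable
  set T : ℕ → (Link → ℝ) × ℝ → ℝ≥0∞ := fun n m => negExp (ENNReal.ofReal s * ENNReal.ofReal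
      (p.M * m.1 (p.link ‖u + y n‖) ^ 2 * fejer p.M m.2 * p.pathLoss ‖u + y n‖))
  have hT : ∀ n, Measurable (T n) := fun n =>
    continuous_negExp.measurable.comp (by fun_prop)
  set X : ℕ → Ω → ℝ≥0∞ := fun n ω => T n ((fun κ => G n κ ω), ϑ n ω)
  have hX : ∀ n, Measurable (X n) := fun n => (hT n).comp (measurable_marks hnet n)
  have hind : iIndepFun X μ := hnet.indep_marks.comp T hT
  have hmean : ∀ n, ∫⁻ ω, X n ω ∂μ = negExp (negLog (meanLinkLaplace p s ‖u + y n‖)) := by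
    intro n
    rw [negExp_negLog (meanLinkLaplace_le_one p hs (norm_nonneg _))]
    exact lintegral_negExp_mark hnet hs (norm_nonneg _) n
  have hlim1 : Tendsto (fun k => ∫⁻ ω, ∏ n ∈ Finset.range k, X n ω ∂μ) atTop
      (𝓝 (∫⁻ ω, negExp (ENNReal.ofReal s *
        interferenceAt p u y (fun n => ((fun κ => G n κ ω), ϑ n ω))) ∂μ)) := by
    refine tendsto_lintegral_of_dominated_convergence (fun _ => 1) (fun k => ?_) (fun k => ?_)
      (by simp) (ae_of_all _ fun ω => ?_)
    · exact Finset.measurable_fun_prod _ fun n _ => hX n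
    · exact ae_of_all _ fun ω => Finset.prod_le_one' fun n _ => negExp_le_one _
    · rw [interferenceAt, ← ENNReal.tsum_mul_left]
      exact tendsto_prod_negExp _
  have hlim2 := tendsto_prod_negExp fun n => negLog (meanLinkLaplace p s ‖u + y n‖)
  simp only [lintegral_prod_eq_prod_lintegral_of_indepFun _ X hind hX, hmean] at hlim1
  exact tendsto_nhds_unique hlim1 hlim2

/-- The Laplace transform of the interference at a fixed point `u` of the plane. It does not depend
on `u`, because the Poisson process is stationary. -/
theorem lintegral_negExp_interferenceAt [IsProbabilityMeasure μ]
    (hnet : IsNetwork p μ user near g Y G ϑ) {s : ℝ}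
    (hs : 0 ≤ s) (u : Plane) :
    ∫⁻ ω, negExp (ENNReal.ofReal s * interferenceAt p u (fun n => Y n ω)
      (fun n => ((fun κ => G n κ ω), ϑ n ω))) ∂μ =
      ENNReal.ofReal (Real.exp (-interferenceExponent p s)) := by
  have hYm : Measurable fun ω n => Y n ω := measurable_pi_lambda _ hnet.poisson_Y.measurable
  have hMm : Measurable fun ω => (fun n => ((fun κ => G n κ ω), ϑ n ω) : ℕ → (Link → ℝ) × ℝ) :=
    measurable_pi_lambda _ (measurable_marks hnet)
  set f : (ℕ → Plane) × (ℕ → (Link → ℝ) × ℝ) → ℝ≥0∞ := fun z =>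
    negExp (ENNReal.ofReal s * interferenceAt p u z.1 z.2)
  have hf : Measurable f := continuous_negExp.measurable.comp
    (((measurable_interferenceAt p).comp (measurable_prodMk_left (x := u))).const_mul _)
  rw [lintegral_comp_prod_of_indepFun hYm hMm hnet.indep_Y_marks hf]
  simp only [f, lintegral_negExp_marks hnet hs]
  have hφ : Measurable fun y : Plane => negLog (meanLinkLaplace p s ‖u + y‖) :=
    measurable_negLog.comp ((measurable_meanLinkLaplace p s).comp (by fun_prop))
  have hσ : SigmaFinite (ENNReal.ofReal p.density • (volume : Measure Plane)) :=
    inferInstanceAs (SigmaFinite (p.density.toNNReal • (volume : Measure Plane)))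
  rw [lintegral_negExp_poissonProcess hnet.poisson_Y hφ, lintegral_smul_measure]
  simp only [negExp_negLog (meanLinkLaplace_le_one p hs (norm_nonneg _))]
  rw [lintegral_add_left_eq_self (fun z : Plane => 1 - meanLinkLaplace p s ‖z‖) u, smul_eq_mul,
    lintegral_one_sub_meanLinkLaplace p hs, negExp_ofReal]
  have := p.spacing_pos
  have := p.wavelength_pos
  have := p.density_pos
  refine mul_nonneg (by positivity) (mul_nonneg (by positivity) ?_)
  refine intervalIntegral.integral_nonneg ?_ fun x _ => quadIntegrand_nonneg p hs x
  have : 0 < p.spacing / p.wavelength := by positivity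
  linarith

end Network

/-! ### The position of the nearest user -/

theorem nearestDensity_eq (p : Params) (r : ℝ) : nearestDensity p r =
    2 * (p.K / p.sigma ^ 2) * r * Real.exp (-(p.K / p.sigma ^ 2 * r ^ 2)) := by
  rw [nearestDensity]
  ring_nf

theorem integral_Ioi_rayleigh {b a : ℝ} (hb : 0 < b) (ha : 0 ≤ a) :
    IntegrableOn (fun y => 2 * b * y * Real.exp (-(b * y ^ 2))) (Ioi a) ∧
      ∫ y in Ioi a, 2 * b * y * Real.exp (-(b * y ^ 2)) = Real.exp (-(b * a ^ 2)) := by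
  have hderiv : ∀ y ∈ Ioi a, HasDerivAt (fun y => -Real.exp (-(b * y ^ 2)))
      (2 * b * y * Real.exp (-(b * y ^ 2))) y := by
    intro y _
    have := (((hasDerivAt_pow 2 y).const_mul b).neg.exp).neg
    refine this.congr_deriv ?_
    simp only [Pi.neg_apply]
    push_cast
    ring
  have hnonneg : ∀ y ∈ Ioi a, 0 ≤ 2 * b * y * Real.exp (-(b * y ^ 2)) := by
    intro y hy
    have : 0 < y := ha.trans_lt hy
    positivity
  have hcont : ContinuousWithinAt (fun y => -Real.exp (-(b * y ^ 2))) (Ici a) a :=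
    Continuous.continuousWithinAt (by fun_prop)
  have hlim : Tendsto (fun y => -Real.exp (-(b * y ^ 2))) atTop (𝓝 0) := by
    have : Tendsto (fun y : ℝ => b * y ^ 2) atTop atTop :=
      (tendsto_pow_atTop two_ne_zero).const_mul_atTop hb
    simpa using (Real.tendsto_exp_neg_atTop_nhds_zero.comp this).neg
  refine ⟨integrableOn_Ioi_deriv_of_nonneg hcont hderiv hnonneg hlim, ?_⟩
  rw [integral_Ioi_of_hasDerivAt_of_nonneg hcont hderiv hnonneg hlim]
  ring

/-- The distance of a user has a Rayleigh law. -/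
theorem userLaw_norm_ge {sigma r : ℝ} (hσ : 0 < sigma) (hr : 0 ≤ r) :
    userLaw sigma {x | r ≤ ‖x‖} = ENNReal.ofReal (Real.exp (-(r ^ 2 / (2 * sigma ^ 2)))) := by
  set b := (2 * sigma ^ 2)⁻¹ with hb
  have hb0 : 0 < b := by positivity
  set d : ℝ → ℝ := fun t => 1 / (2 * Real.pi * sigma ^ 2) * Real.exp (-t ^ 2 / (2 * sigma ^ 2))
  have hS : MeasurableSet {x : Plane | r ≤ ‖x‖} := measurableSet_le measurable_const measurable_norm
  obtain ⟨hi, hv⟩ := integral_Ioi_rayleigh hb0 hr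
  set F : ℝ → ℝ := (Ici r).indicator d with hF
  have hF0 : ∀ t, 0 ≤ F t := fun t => indicator_nonneg (fun t _ => by positivity) t
  have hmain : ∀ y, y ^ (Module.finrank ℝ Plane - 1) • F y =
      (Ici r).indicator (fun y => (2 * Real.pi)⁻¹ * (2 * b * y * Real.exp (-(b * y ^ 2)))) y := by
    intro y
    rw [finrank_plane, hF]
    by_cases hy : y ∈ Ici r
    · rw [indicator_of_mem hy, indicator_of_mem hy, hb]
      simp only [d]
      have : -y ^ 2 / (2 * sigma ^ 2) = -((2 * sigma ^ 2)⁻¹ * y ^ 2) := by field_simp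
      rw [this]
      simp only [Nat.add_one_sub_one, pow_one, smul_eq_mul]
      field_simp
    · rw [indicator_of_notMem hy, indicator_of_notMem hy, smul_zero]
  have hsets : (Ioi 0 ∩ Ici r : Set ℝ) =ᵐ[volume] Ioi r := by
    have h1 : Ioi (0 : ℝ) ∩ Ioi r = Ioi r := by
      rw [Ioi_inter_Ioi, max_eq_right hr]
    rw [← h1]
    exact (ae_eq_refl _).inter Ioi_ae_eq_Ici.symm
  have hint : Integrable fun x : Plane => F ‖x‖ := by
    rw [integrable_fun_norm_addHaar volume]
    simp only [hmain]
    rw [IntegrableOn, integrable_indicator_iff measurableSet_Ici, IntegrableOn,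
      Measure.restrict_restrict measurableSet_Ici, inter_comm, Measure.restrict_congr_set hsets]
    exact hi.const_mul _
  rw [userLaw, withDensity_apply _ hS, ← lintegral_indicator hS]
  have hpt : ∀ x : Plane, {x : Plane | r ≤ ‖x‖}.indicator
      (fun x => ENNReal.ofReal (d ‖x‖)) x = ENNReal.ofReal (F ‖x‖) := by
    intro x
    by_cases hx : r ≤ ‖x‖
    · have h1 : x ∈ {x : Plane | r ≤ ‖x‖} := hx
      rw [indicator_of_mem h1, hF, indicator_of_mem (mem_Ici.2 hx)]
    · have h1 : x ∉ {x : Plane | r ≤ ‖x‖} := hx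
      have h2 : ‖x‖ ∉ Ici r := hx
      rw [indicator_of_notMem h1, hF, indicator_of_notMem h2, ENNReal.ofReal_zero]
  refine (lintegral_congr hpt).trans ?_
  rw [← ofReal_integral_eq_lintegral_ofReal hint (ae_of_all _ fun x => hF0 _),
    integral_fun_norm_addHaar volume F]
  simp only [hmain]
  rw [setIntegral_indicator measurableSet_Ici, setIntegral_congr_set hsets, integral_const_mul, hv,
    volume_real_unit_ball_plane, finrank_plane, hb]
  congr 1
  simp only [smul_eq_mul, nsmul_eq_mul]
  have : -((2 * sigma ^ 2)⁻¹ * r ^ 2) = -(r ^ 2 / (2 * sigma ^ 2)) := by field_simp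
  rw [this]
  push_cast
  field_simp

/-- The sum of the points of least norm: the nearest point, if there are no ties. Unlike the label
of the near user, it is a function of the positions alone, and so it is independent of whatever the
positions are independent of. -/
noncomputable def nearestPoint {n : ℕ} (U : Fin n → Plane) : Plane :=
  ∑ i, {V : Fin n → Plane | ∀ j, ‖V i‖ ≤ ‖V j‖}.indicator (fun V => V i) U

theorem measurable_nearestPoint {n : ℕ} : Measurable (nearestPoint (n := n)) := by
  refine Finset.measurable_fun_sum _ fun i _ => (measurable_pi_apply i).indicator ?_
  simp only [ofPred_forall]
  exact MeasurableSet.iInter fun j => measurableSet_le (by fun_prop) (by fun_prop)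

theorem nearestPoint_eq {n : ℕ} {U : Fin n → Plane} {i : Fin n} (hi : ∀ j, ‖U i‖ ≤ ‖U j‖)
    (hU : ∀ j k, j ≠ k → ‖U j‖ ≠ ‖U k‖) : nearestPoint U = U i := by
  rw [nearestPoint, Finset.sum_eq_single i]
  · have h : U ∈ {V : Fin n → Plane | ∀ j, ‖V i‖ ≤ ‖V j‖} := hi
    exact indicator_of_mem h _
  · intro j _ hj
    refine indicator_of_notMem (fun h => ?_) _
    have h' : ∀ k, ‖U j‖ ≤ ‖U k‖ := h
    exact hU j i hj (le_antisymm (h' i) (hi j))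
  · simp

section Network

variable {p : Params} {Ω : Type*} [MeasurableSpace Ω] {μ : Measure Ω}
  {user : Fin (2 * p.K) → Ω → Plane} {near : Ω → Fin (2 * p.K)} {g : Link → Ω → ℝ}
  {Y : ℕ → Ω → Plane} {G : ℕ → Link → Ω → ℝ} {ϑ : ℕ → Ω → ℝ}

/-- Almost surely, no two users are at the same distance, because circles are null sets. -/
theorem ae_norm_user_ne [IsProbabilityMeasure μ] (hnet : IsNetwork p μ user near g Y G ϑ) :
    ∀ᵐ ω ∂μ, ∀ i j, i ≠ j → ‖user i ω‖ ≠ ‖user j ω‖ := by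
  simp only [ae_all_iff]
  intro i j hij
  have hS : MeasurableSet {z : Plane × Plane | ‖z.1‖ = ‖z.2‖} :=
    measurableSet_eq_fun (by fun_prop) (by fun_prop)
  have h := lintegral_comp_prod_of_indepFun (hnet.measurable_user i) (hnet.measurable_user j)
    (hnet.indep_user.indepFun hij)
    (f := {z : Plane × Plane | ‖z.1‖ = ‖z.2‖}.indicator 1) (measurable_one.indicator hS)
  have hsphere : ∀ x : Plane, ∫⁻ ω, {z : Plane × Plane | ‖z.1‖ = ‖z.2‖}.indicator 1
      (x, user j ω) ∂μ = 0 := by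
    intro x
    have hm : Measurable fun y : Plane =>
        {z : Plane × Plane | ‖z.1‖ = ‖z.2‖}.indicator (1 : Plane × Plane → ℝ≥0∞) (x, y) :=
      (measurable_one.indicator hS).comp measurable_prodMk_left
    rw [(hnet.hasLaw_user j).lintegral_comp hm.aemeasurable, lintegral_eq_zero_iff hm]
    refine (withDensity_absolutelyContinuous volume _).ae_eq ?_
    have h0 := Measure.addHaar_sphere (volume : Measure Plane) 0 ‖x‖
    filter_upwards [measure_eq_zero_iff_ae_notMem.1 h0] with y hy
    refine indicator_of_notMem (fun h => hy ?_) _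
    simpa using (show ‖x‖ = ‖y‖ from h).symm
  simp only [hsphere, lintegral_zero] at h
  have hm : Measurable fun ω => {z : Plane × Plane | ‖z.1‖ = ‖z.2‖}.indicator
      (1 : Plane × Plane → ℝ≥0∞) (user i ω, user j ω) := by
    have := (measurable_one (α := ℝ≥0∞).indicator hS).comp
      ((hnet.measurable_user i).prodMk (hnet.measurable_user j))
    exact this
  rw [lintegral_eq_zero_iff hm] at h
  filter_upwards [h] with ω hω heq
  simp [indicator, heq] at hω

/-- The near user is at the nearest point, whatever rule its label uses to break ties. -/
theorem near_user_ae_eq [IsProbabilityMeasure μ] (hnet : IsNetwork p μ user near g Y G ϑ) :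
    (fun ω => nearestPoint fun i => user i ω) =ᵐ[μ] fun ω => user (near ω) ω := by
  filter_upwards [ae_norm_user_ne hnet] with ω hω
  exact nearestPoint_eq (U := fun i => user i ω) (hnet.near_nearest ω) hω

theorem measurable_near_user (hnet : IsNetwork p μ user near g Y G ϑ) :
    Measurable fun ω => user (near ω) ω := by
  have : Measurable fun z : Fin (2 * p.K) × Ω => user z.1 z.2 :=
    measurable_from_prod_countable_right hnet.measurable_user
  exact this.comp (hnet.measurable_near.prodMk measurable_id)

/-- The distance of the near user has density `nearestDensity`: it exceeds `a` if all `2 * K`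
independent Rayleigh distributed distances do. -/
theorem map_norm_near_user [IsProbabilityMeasure μ] (hnet : IsNetwork p μ user near g Y G ϑ) :
    μ.map (fun ω => ‖user (near ω) ω‖) =
      (volume.restrict (Ioi 0)).withDensity fun r => ENNReal.ofReal (nearestDensity p r) := by
  have hK : (0 : ℝ) < p.K := by exact_mod_cast p.K_pos
  have hσ := p.sigma_pos
  have hm : Measurable fun ω => ‖user (near ω) ω‖ := (measurable_near_user hnet).norm
  have hP := Measure.isProbabilityMeasure_map (μ := μ) hm.aemeasurable
  refine Measure.ext_of_Ici _ _ fun a => ?_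
  have hb : 0 < p.K / p.sigma ^ 2 := by positivity
  have ha : 0 ≤ max a 0 := le_max_right _ _
  obtain ⟨hi, hv⟩ := integral_Ioi_rayleigh hb ha
  have hleft : μ.map (fun ω => ‖user (near ω) ω‖) (Ici a) =
      ENNReal.ofReal (Real.exp (-(p.K / p.sigma ^ 2 * max a 0 ^ 2))) := by
    rw [Measure.map_apply hm measurableSet_Ici]
    have hset : (fun ω => ‖user (near ω) ω‖) ⁻¹' Ici a =
        ⋂ i ∈ Finset.univ, user i ⁻¹' {x | max a 0 ≤ ‖x‖} := by
      ext ω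
      simp only [mem_preimage, mem_Ici, Finset.mem_univ, iInter_true, mem_iInter, mem_ofPred_eq,
        max_le_iff, norm_nonneg, and_true]
      exact ⟨fun h i => h.trans (hnet.near_nearest ω i), fun h => h _⟩
    have hS : MeasurableSet {x : Plane | max a 0 ≤ ‖x‖} :=
      measurableSet_le measurable_const measurable_norm
    rw [hset, hnet.indep_user.measure_inter_preimage_eq_mul Finset.univ fun i _ => hS]
    have : ∀ i, μ (user i ⁻¹' {x | max a 0 ≤ ‖x‖}) =
        ENNReal.ofReal (Real.exp (-(max a 0 ^ 2 / (2 * p.sigma ^ 2)))) := by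
      intro i
      rw [← Measure.map_apply (hnet.measurable_user i) hS, (hnet.hasLaw_user i).map_eq,
        userLaw_norm_ge hσ ha]
    simp only [this, Finset.prod_const, Finset.card_univ, Fintype.card_fin]
    rw [← ENNReal.ofReal_pow (Real.exp_pos _).le, ← Real.exp_nat_mul]
    congr 2
    push_cast
    field_simp
  have hsets : (Ici a ∩ Ioi 0 : Set ℝ) =ᵐ[volume] Ioi (max a 0) := by
    rw [← Ioi_inter_Ioi]
    exact Ioi_ae_eq_Ici.symm.inter (ae_eq_refl _)
  rw [hleft, withDensity_apply _ measurableSet_Ici, Measure.restrict_restrict measurableSet_Ici,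
    Measure.restrict_congr_set hsets]
  simp only [nearestDensity_eq]
  rw [← ofReal_integral_eq_lintegral_ofReal hi, hv]
  filter_upwards [self_mem_ae_restrict measurableSet_Ioi] with y hy
  have : 0 < y := ha.trans_lt hy
  simp only [Pi.zero_apply]
  positivity

end Network

/-! ### The analytical expression -/

theorem integrableOn_nearestDensity (p : Params) : IntegrableOn (nearestDensity p) (Ici 0) := by
  have hK : (0 : ℝ) < p.K := by exact_mod_cast p.K_pos
  have hσ := p.sigma_pos
  rw [integrableOn_Ici_iff_integrableOn_Ioi, funext (nearestDensity_eq p)]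
  exact (integral_Ioi_rayleigh (by positivity) le_rfl).1

theorem nearestDensity_nonneg (p : Params) {r : ℝ} (hr : 0 ≤ r) : 0 ≤ nearestDensity p r := by
  have := p.sigma_pos
  unfold nearestDensity
  positivity

/-- The Laplace transform in the `n`-th term of `Theta` is taken at a nonnegative argument. -/
theorem theta_arg_nonneg (p : Params) {τ β : ℝ} (hτ : 0 ≤ τ) (hβ : 0 ≤ β) (κ : Link) (n : ℕ) {r : ℝ}
    (hr : 0 ≤ r) : 0 ≤ n * psi (p.N κ) * τ * r ^ p.expo κ / (β * p.M * p.C κ) := by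
  have := (psi_pos (p.N_pos κ)).le
  have := (p.C_pos κ).le
  positivity

theorem expo_pos (p : Params) (κ : Link) : 0 < p.expo κ := by
  cases κ
  · exact p.expo_los_pos
  · exact two_pos.trans p.two_lt_expo_nlos

theorem continuousOn_Theta (p : Params) {lap : ℝ → ℝ} (hc : ContinuousOn lap (Ici 0)) {τ β : ℝ}
    (hτ : 0 ≤ τ) (hβ : 0 ≤ β) (κ : Link) :
    ContinuousOn (fun r => Theta p lap κ r τ β) (Ici 0) := by
  have hpow : Continuous fun r : ℝ => r ^ p.expo κ := Real.continuous_rpow_const (expo_pos p κ).le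
  refine continuousOn_finsetSum _ fun n _ => ?_
  refine ContinuousOn.mul (Continuous.continuousOn (by fun_prop)) ?_
  refine hc.comp (Continuous.continuousOn (by fun_prop)) fun r hr => ?_
  exact theta_arg_nonneg p hτ hβ κ n hr

/-- A bound for `Theta`, uniform in the distance and in the Laplace transform. -/
theorem abs_Theta_le (p : Params) {lap : ℝ → ℝ} (hl : ∀ s, 0 ≤ s → |lap s| ≤ 1) {τ β : ℝ}
    (hτ : 0 ≤ τ) (hβ : 0 ≤ β) (κ : Link) {r : ℝ} (hr : 0 ≤ r) :
    |Theta p lap κ r τ β| ≤ ∑ n ∈ Finset.Icc 1 (p.N κ), ((p.N κ).choose n : ℝ) := by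
  refine (Finset.abs_sum_le_sum_abs _ _).trans (Finset.sum_le_sum fun n _ => ?_)
  have h0 := theta_arg_nonneg p hτ hβ κ n hr
  have h1 : 0 ≤ n * psi (p.N κ) * τ * r ^ p.expo κ * p.noise / (β * p.M * p.C κ) := by
    have := mul_nonneg h0 p.noise_pos.le
    rwa [div_mul_eq_mul_div] at this
  rw [abs_mul, abs_mul, abs_mul, abs_pow, abs_neg, abs_one, one_pow, one_mul, Nat.abs_cast,
    Real.abs_exp, mul_assoc]
  refine mul_le_of_le_one_right (Nat.cast_nonneg _) ?_
  exact mul_le_one₀ (Real.exp_le_one_iff.2 (neg_nonpos.2 h1)) (abs_nonneg _) (hl _ h0)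

theorem integrableOn_Theta_mul (p : Params) {lap : ℝ → ℝ} (hc : ContinuousOn lap (Ici 0))
    (hl : ∀ s, 0 ≤ s → |lap s| ≤ 1) {τ β : ℝ} (hτ : 0 ≤ τ) (hβ : 0 ≤ β) (κ : Link) :
    IntegrableOn (fun r => Theta p lap κ r τ β * nearestDensity p r) (Ici 0) := by
  refine (integrableOn_nearestDensity p).bdd_mul
    ((continuousOn_Theta p hc hτ hβ κ).aestronglyMeasurable measurableSet_Ici)
    (c := ∑ n ∈ Finset.Icc 1 (p.N κ), ((p.N κ).choose n : ℝ)) ?_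
  filter_upwards [self_mem_ae_restrict measurableSet_Ici] with r hr
  exact abs_Theta_le p hl hτ hβ κ hr

theorem formulaIntegrable (p : Params) {lap : ℝ → ℝ} (hc : ContinuousOn lap (Ici 0))
    (hl : ∀ s, 0 ≤ s → |lap s| ≤ 1) {τ β : ℝ} (hτ : 0 ≤ τ) (hβ : 0 ≤ β) :
    FormulaIntegrable p lap τ β :=
  ⟨(integrableOn_Theta_mul p hc hl hτ hβ Link.los).mono_set Icc_subset_Ici_self,
    (integrableOn_Theta_mul p hc hl hτ hβ Link.nlos).mono_set (Ici_subset_Ici.2 p.RL_pos.le)⟩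

/-- The analytical expression is continuous under pointwise convergence of the Laplace transform, by
dominated convergence. -/
theorem tendsto_coverageFormula (p : Params) {lap : ℕ → ℝ → ℝ} {lim : ℝ → ℝ}
    (hc : ∀ k, ContinuousOn (lap k) (Ici 0)) (hl : ∀ k s, 0 ≤ s → |lap k s| ≤ 1)
    (hlim : ∀ s, 0 ≤ s → Tendsto (fun k => lap k s) atTop (𝓝 (lim s))) {τ β : ℝ} (hτ : 0 ≤ τ)
    (hβ : 0 ≤ β) :
    Tendsto (fun k => coverageFormula p (lap k) τ β) atTop (𝓝 (coverageFormula p lim τ β)) := by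
  have key : ∀ κ, ∀ S ⊆ Ici (0 : ℝ), MeasurableSet S →
      Tendsto (fun k => ∫ r in S, Theta p (lap k) κ r τ β * nearestDensity p r) atTop
        (𝓝 (∫ r in S, Theta p lim κ r τ β * nearestDensity p r)) := by
    intro κ S hS hSm
    refine tendsto_integral_of_dominated_convergence
      (fun r => (∑ n ∈ Finset.Icc 1 (p.N κ), ((p.N κ).choose n : ℝ)) * nearestDensity p r)
      (fun k => ?_) ?_ (fun k => ?_) ?_
    · exact ((integrableOn_Theta_mul p (hc k) (hl k) hτ hβ κ).mono_set hS).aestronglyMeasurable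
    · exact ((integrableOn_nearestDensity p).mono_set hS).const_mul _
    · filter_upwards [self_mem_ae_restrict hSm] with r hr
      rw [norm_mul, Real.norm_of_nonneg (nearestDensity_nonneg p (hS hr))]
      exact mul_le_mul_of_nonneg_right (abs_Theta_le p (hl k) hτ hβ κ (hS hr))
        (nearestDensity_nonneg p (hS hr))
    · filter_upwards [self_mem_ae_restrict hSm] with r hr
      refine Tendsto.mul_const _ (tendsto_finsetSum _ fun n _ => Tendsto.const_mul _ ?_)
      exact hlim _ (theta_arg_nonneg p hτ hβ κ n (hS hr))
  exact (key _ _ Icc_subset_Ici_self measurableSet_Icc).add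
    (key _ _ (Ici_subset_Ici.2 p.RL_pos.le) measurableSet_Ici)

/-- The analytical expression is an expectation over the distance of the near user. -/
theorem coverageFormula_eq_integral (p : Params) {lap : ℝ → ℝ} (hc : ContinuousOn lap (Ici 0))
    (hl : ∀ s, 0 ≤ s → |lap s| ≤ 1) {τ β : ℝ} (hτ : 0 ≤ τ) (hβ : 0 ≤ β) :
    coverageFormula p lap τ β = ∫ r, Theta p lap (p.link r) r τ β
      ∂(volume.restrict (Ioi 0)).withDensity fun r => ENNReal.ofReal (nearestDensity p r) := by
  have hm : Measurable fun r => (nearestDensity p r).toNNReal := by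
    unfold nearestDensity
    fun_prop
  have h1 := integral_withDensity_eq_integral_smul (μ := volume.restrict (Ioi 0)) hm
    fun r => Theta p lap (p.link r) r τ β
  refine Eq.trans ?_ h1.symm
  have e : ∫ r in Ioi 0, (nearestDensity p r).toNNReal • Theta p lap (p.link r) r τ β =
      ∫ r in Ioi 0, Theta p lap (p.link r) r τ β * nearestDensity p r := by
    refine setIntegral_congr_fun measurableSet_Ioi fun r hr => ?_
    simp only [NNReal.smul_def, smul_eq_mul,
      Real.coe_toNNReal _ (nearestDensity_nonneg p (le_of_lt hr)), mul_comm]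
  rw [e, ← Ioc_union_Ioi_eq_Ioi p.RL_pos.le]
  have e1 : EqOn (fun r => Theta p lap Link.los r τ β * nearestDensity p r)
      (fun r => Theta p lap (p.link r) r τ β * nearestDensity p r) (Ioc 0 p.RL) := fun r hr => by
    simp only [link_of_le p hr.2]
  have e2 : EqOn (fun r => Theta p lap Link.nlos r τ β * nearestDensity p r)
      (fun r => Theta p lap (p.link r) r τ β * nearestDensity p r) (Ioi p.RL) := fun r hr => by
    simp only [link_of_lt p hr]
  have i1 := ((integrableOn_Theta_mul p hc hl hτ hβ Link.los).mono_set
    (Ioc_subset_Icc_self.trans Icc_subset_Ici_self)).congr_fun e1 measurableSet_Ioc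
  have i2 := ((integrableOn_Theta_mul p hc hl hτ hβ Link.nlos).mono_set
    (Ioi_subset_Ici p.RL_pos.le)).congr_fun e2 measurableSet_Ioi
  rw [setIntegral_union (Ioc_disjoint_Ioi le_rfl) measurableSet_Ioi i1 i2,
    ← setIntegral_congr_fun measurableSet_Ioc e1, ← setIntegral_congr_fun measurableSet_Ioi e2,
    coverageFormula, integral_Icc_eq_integral_Ioc, integral_Ici_eq_integral_Ioi]

/-- The binomial expansion behind `Theta`. -/
theorem one_sub_one_sub_pow (N : ℕ) (z : ℝ) :
    1 - (1 - z) ^ N = ∑ n ∈ Finset.Icc 1 N, (-1) ^ (n + 1) * (N.choose n : ℝ) * z ^ n := by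
  have h : (1 - z) ^ N = ∑ n ∈ Finset.range (N + 1), (-1) ^ n * (N.choose n : ℝ) * z ^ n := by
    rw [sub_eq_neg_add, add_pow]
    refine Finset.sum_congr rfl fun n _ => ?_
    rw [neg_pow, one_pow]
    ring
  rw [h, Finset.range_eq_Ico, Finset.sum_eq_sum_Ico_succ_bot (Nat.succ_pos N),
    ← Finset.Ico_add_one_right_eq_Icc]
  simp only [pow_zero, Nat.choose_zero_right, Nat.cast_one, mul_one, sub_add_cancel_left,
    zero_add]
  rw [← Finset.sum_neg_distrib]
  refine Finset.sum_congr rfl fun n _ => ?_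
  rw [pow_succ]
  ring

/-! ### Coverage as a tail of the Gamma distribution -/

/-- The threshold that the squared fading amplitude has to exceed for coverage, if the near user is
at `x` and the interfering base stations and their marks are `w`. -/
noncomputable def fadingThreshold (p : Params) (τ β : ℝ) (x : Plane)
    (w : (ℕ → Plane) × (ℕ → (Link → ℝ) × ℝ)) : ℝ :=
  τ * ‖x‖ ^ p.expo (p.link ‖x‖) * ((interferenceAt p x w.1 w.2).toReal + p.noise) /
    (β * p.M * p.C (p.link ‖x‖))

theorem fadingThreshold_nonneg (p : Params) {τ β : ℝ} (hτ : 0 ≤ τ) (hβ : 0 ≤ β) (x : Plane)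
    (w : (ℕ → Plane) × (ℕ → (Link → ℝ) × ℝ)) : 0 ≤ fadingThreshold p τ β x w := by
  have := p.noise_pos
  have := p.C_pos (p.link ‖x‖)
  have : 0 ≤ (interferenceAt p x w.1 w.2).toReal := ENNReal.toReal_nonneg
  unfold fadingThreshold
  positivity

theorem measurable_fadingThreshold (p : Params) (τ β : ℝ) :
    Measurable fun z : Plane × (ℕ → Plane) × (ℕ → (Link → ℝ) × ℝ) =>
      fadingThreshold p τ β z.1 z.2 := by
  have hI := (measurable_interferenceAt p).ennreal_toReal
  refine measurable_link_rec p (r := fun z : Plane × (ℕ → Plane) × (ℕ → (Link → ℝ) × ℝ) => ‖z.1‖)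
    (by fun_prop) (f := fun κ z => τ * ‖z.1‖ ^ p.expo κ *
      ((interferenceAt p z.1 z.2.1 z.2.2).toReal + p.noise) / (β * p.M * p.C κ)) fun κ => ?_
  exact ((Measurable.mul (by fun_prop) (hI.add_const _)).div_const _)

/-- The tail of the squared Nakagami amplitude. -/
theorem nakagamiMeasure_sq_gt {N : ℕ} (hN : 0 < N) {t : ℝ} (ht : 0 ≤ t) :
    nakagamiMeasure N {a | t < a ^ 2} = ENNReal.ofReal (1 - cdf (gammaMeasure N N) t) := by
  have hN' : (0 : ℝ) < N := by exact_mod_cast hN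
  have hP := isProbabilityMeasure_gammaMeasure hN' hN'
  have hS : MeasurableSet {a : ℝ | t < a ^ 2} := measurableSet_lt measurable_const (by fun_prop)
  rw [nakagamiMeasure, Measure.map_apply (by fun_prop) hS]
  have hset : Real.sqrt ⁻¹' {a | t < a ^ 2} = (Iic t)ᶜ := by
    ext x
    simp only [mem_preimage, mem_ofPred_eq, mem_compl_iff, mem_Iic, not_le]
    rcases le_total 0 x with hx | hx
    · rw [Real.sq_sqrt hx]
    · rw [Real.sqrt_eq_zero_of_nonpos hx]
      constructor <;> intro h <;> linarith
  rw [hset, prob_compl_eq_one_sub measurableSet_Iic, cdf_eq_real,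
    ENNReal.ofReal_sub _ (by positivity), ENNReal.ofReal_one, ofReal_measureReal]

/-- In the regime of the theorem, success of the second decoding step implies success of
interference cancellation. -/
theorem sic_of_near {ak aj τj τk S J : ℝ} (hτj : 0 < τj) (hτk : 0 < τk) (hak : 0 < ak)
    (hJ : 0 < J) (hregime : ak * τj * (1 + 1 / τk) < aj) (h : τk * J < ak * S) :
    τj * (ak * S + J) < aj * S := by
  have hS : 0 < S := by
    have : 0 < ak * S := (mul_pos hτk hJ).trans h
    exact (mul_pos_iff_of_pos_left hak).1 this
  have h1 : J < ak * S / τk := by rw [lt_div_iff₀ hτk]; linarith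
  have h2 : τj * (ak * S + J) < τj * (ak * S + ak * S / τk) := by gcongr
  have h3 : τj * (ak * S + ak * S / τk) = ak * τj * (1 + 1 / τk) * S := by
    field_simp
  have h4 : ak * τj * (1 + 1 / τk) * S < aj * S := by gcongr
  linarith

section Network

variable {p : Params} {Ω : Type*} [MeasurableSpace Ω] {μ : Measure Ω}
  {user : Fin (2 * p.K) → Ω → Plane} {near : Ω → Fin (2 * p.K)} {g : Link → Ω → ℝ}
  {Y : ℕ → Ω → Plane} {G : ℕ → Link → Ω → ℝ} {ϑ : ℕ → Ω → ℝ}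

/-- The interfering base stations and their marks. -/
def interferers (Y : ℕ → Ω → Plane) (G : ℕ → Link → Ω → ℝ) (ϑ : ℕ → Ω → ℝ) (ω : Ω) :
    (ℕ → Plane) × (ℕ → (Link → ℝ) × ℝ) :=
  (fun n => Y n ω, fun n => ((fun κ => G n κ ω), ϑ n ω))

theorem measurable_interferers (hnet : IsNetwork p μ user near g Y G ϑ) :
    Measurable (interferers Y G ϑ) :=
  (measurable_pi_lambda _ hnet.poisson_Y.measurable).prodMk
    (measurable_pi_lambda _ (measurable_marks hnet))

theorem indepFun_near_user [IsProbabilityMeasure μ] (hnet : IsNetwork p μ user near g Y G ϑ) :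
    IndepFun (fun ω => user (near ω) ω)
      (fun ω => ((fun κ => g κ ω : Link → ℝ), interferers Y G ϑ ω)) μ :=
  (hnet.indep_users_rest.comp measurable_nearestPoint measurable_id).congr
    (near_user_ae_eq hnet) (ae_eq_refl _)

theorem indepFun_near_user_interferers [IsProbabilityMeasure μ]
    (hnet : IsNetwork p μ user near g Y G ϑ) :
    IndepFun (fun ω => user (near ω) ω) (interferers Y G ϑ) μ :=
  (indepFun_near_user hnet).comp measurable_id measurable_snd

theorem exp_interferenceExponent_le_one (p : Params) {s : ℝ} (hs : 0 ≤ s) :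
    Real.exp (-interferenceExponent p s) ≤ 1 :=
  le_of_tendsto (tendsto_laplaceClosed p hs)
    (Eventually.of_forall fun n => laplaceClosed_le_one p n hs)

/-- The interference at a fixed point is almost surely finite: its Laplace transform tends to `1`
at `0`. -/
theorem ae_interferenceAt_ne_top [IsProbabilityMeasure μ]
    (hnet : IsNetwork p μ user near g Y G ϑ) (u : Plane) :
    ∀ᵐ ω ∂μ, interferenceAt p u (interferers Y G ϑ ω).1 (interferers Y G ϑ ω).2 ≠ ∞ := by
  set I : Ω → ℝ≥0∞ := fun ω =>
    interferenceAt p u (interferers Y G ϑ ω).1 (interferers Y G ϑ ω).2 with hI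
  have hIm : Measurable I := by
    have := (measurable_interferenceAt p).comp
      ((measurable_const (a := u)).prodMk (measurable_interferers hnet))
    exact this
  have hS : MeasurableSet {ω | I ω ≠ ∞} := (hIm (measurableSet_singleton ∞)).compl
  have hle : ∀ s, 0 < s → ENNReal.ofReal (Real.exp (-interferenceExponent p s)) ≤
      μ {ω | I ω ≠ ∞} := by
    intro s hs
    rw [← lintegral_negExp_interferenceAt hnet hs.le u, ← lintegral_indicator_one hS]
    refine lintegral_mono fun ω => ?_
    by_cases h : I ω = ∞
    · have h' : interferenceAt p u (fun n => Y n ω) (fun n => ((fun κ => G n κ ω), ϑ n ω)) = ∞ := h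
      simp only [h']
      rw [ENNReal.mul_top (by simpa using hs), negExp_top]
      exact zero_le
    · have h' : ω ∈ {ω | I ω ≠ ∞} := h
      rw [indicator_of_mem h']
      exact negExp_le_one _
  have hlim : Tendsto (fun s => ENNReal.ofReal (Real.exp (-interferenceExponent p s))) (𝓝[>] 0)
      (𝓝 1) := by
    have h1 : Tendsto (interferenceExponent p) (𝓝[>] 0) (𝓝 0) := by
      have := continuousOn_interferenceExponent p 0 self_mem_Ici
      rw [ContinuousWithinAt, interferenceExponent_zero] at this
      exact this.mono_left (nhdsWithin_mono _ Ioi_subset_Ici_self)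
    have h2 := (Real.continuous_exp.tendsto _).comp h1.neg
    have h3 := (ENNReal.continuous_ofReal.tendsto _).comp h2
    rw [neg_zero, Real.exp_zero, ENNReal.ofReal_one] at h3
    exact h3
  have h1 : 1 ≤ μ {ω | I ω ≠ ∞} := le_of_tendsto hlim (by
    filter_upwards [self_mem_nhdsWithin] with s hs using hle s hs)
  exact (prob_compl_eq_zero_iff hS).2 (le_antisymm prob_le_one h1)

theorem ae_interference_ne_top [IsProbabilityMeasure μ]
    (hnet : IsNetwork p μ user near g Y G ϑ) :
    ∀ᵐ ω ∂μ, interference p user near Y G ϑ ω ≠ ∞ := by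
  have hm := measurable_interferenceAt p
  have hS : MeasurableSet {z : Plane × (ℕ → Plane) × (ℕ → (Link → ℝ) × ℝ) |
      interferenceAt p z.1 z.2.1 z.2.2 = ∞} := hm (measurableSet_singleton ∞)
  have hf : Measurable ({z : Plane × (ℕ → Plane) × (ℕ → (Link → ℝ) × ℝ) |
      interferenceAt p z.1 z.2.1 z.2.2 = ∞}.indicator (fun _ => (1 : ℝ≥0∞))) :=
    measurable_const.indicator hS
  have h := lintegral_comp_prod_of_indepFun (measurable_near_user hnet)
    (measurable_interferers hnet) (indepFun_near_user_interferers hnet) hf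
  have h0 : ∀ x, ∫⁻ ω, {z : Plane × (ℕ → Plane) × (ℕ → (Link → ℝ) × ℝ) |
      interferenceAt p z.1 z.2.1 z.2.2 = ∞}.indicator (fun _ => (1 : ℝ≥0∞))
        (x, interferers Y G ϑ ω) ∂μ = 0 := by
    intro x
    refine lintegral_eq_zero_of_ae_eq_zero ?_
    filter_upwards [ae_interferenceAt_ne_top hnet x] with ω hω
    have hn : (x, interferers Y G ϑ ω) ∉ {z : Plane × (ℕ → Plane) × (ℕ → (Link → ℝ) × ℝ) |
      interferenceAt p z.1 z.2.1 z.2.2 = ∞} := hω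
    exact indicator_of_notMem hn _
  simp only [h0, lintegral_zero] at h
  have hm2 : Measurable fun ω => {z : Plane × (ℕ → Plane) × (ℕ → (Link → ℝ) × ℝ) |
      interferenceAt p z.1 z.2.1 z.2.2 = ∞}.indicator (fun _ => (1 : ℝ≥0∞))
        (user (near ω) ω, interferers Y G ϑ ω) := by
    have := hf.comp ((measurable_near_user hnet).prodMk (measurable_interferers hnet))
    exact this
  rw [lintegral_eq_zero_iff hm2] at h
  filter_upwards [h] with ω hω heq
  have heq' : interferenceAt p (user (near ω) ω) (interferers Y G ϑ ω).1
    (interferers Y G ϑ ω).2 = ∞ := heq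
  simp [indicator, heq'] at hω

/-- The Laplace transform of the interference at a fixed point of the plane. -/
theorem integral_exp_interferenceAt [IsProbabilityMeasure μ]
    (hnet : IsNetwork p μ user near g Y G ϑ) {s : ℝ} (hs : 0 ≤ s) (u : Plane) :
    ∫ ω, Real.exp (-(s * (interferenceAt p u (interferers Y G ϑ ω).1
      (interferers Y G ϑ ω).2).toReal)) ∂μ = Real.exp (-interferenceExponent p s) := by
  have hIm : Measurable fun ω =>
      interferenceAt p u (interferers Y G ϑ ω).1 (interferers Y G ϑ ω).2 := by
    have := (measurable_interferenceAt p).comp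
      ((measurable_const (a := u)).prodMk (measurable_interferers hnet))
    exact this
  have hm : Measurable fun ω => Real.exp (-(s * (interferenceAt p u (interferers Y G ϑ ω).1
      (interferers Y G ϑ ω).2).toReal)) :=
    Real.measurable_exp.comp (hIm.ennreal_toReal.const_mul s).neg
  rw [integral_eq_lintegral_of_nonneg_ae (ae_of_all _ fun ω => (Real.exp_pos _).le)
    hm.aestronglyMeasurable]
  have h : ∫⁻ ω, ENNReal.ofReal (Real.exp (-(s * (interferenceAt p u (interferers Y G ϑ ω).1
      (interferers Y G ϑ ω).2).toReal))) ∂μ =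
      ENNReal.ofReal (Real.exp (-interferenceExponent p s)) := by
    rw [← lintegral_negExp_interferenceAt hnet hs u]
    refine lintegral_congr_ae ?_
    filter_upwards [ae_interferenceAt_ne_top hnet u] with ω hω
    have := negExp_ofReal (mul_nonneg hs (ENNReal.toReal_nonneg
      (a := interferenceAt p u (interferers Y G ϑ ω).1 (interferers Y G ϑ ω).2)))
    rw [← this, ENNReal.ofReal_mul hs, ENNReal.ofReal_toReal hω]
    rfl
  rw [h, ENNReal.toReal_ofReal (Real.exp_pos _).le]

/-- Fubini's theorem for independent random variables and a bounded function. -/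
theorem integral_comp_prod_of_indepFun {α β : Type*} [MeasurableSpace α]
    [MeasurableSpace β] [IsProbabilityMeasure μ] {X : Ω → α} {Z : Ω → β}
    (hX : Measurable X) (hZ : Measurable Z) (h : IndepFun X Z μ) {f : α × β → ℝ}
    (hf : Measurable f) {c : ℝ} (hb : ∀ z, |f z| ≤ c) :
    ∫ ω, f (X ω, Z ω) ∂μ = ∫ ω, ∫ ω', f (X ω, Z ω') ∂μ ∂μ := by
  have hP := Measure.isProbabilityMeasure_map (μ := μ) hZ.aemeasurable
  have hP' := Measure.isProbabilityMeasure_map (μ := μ) hX.aemeasurable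
  have hint : Integrable f ((μ.map X).prod (μ.map Z)) :=
    Integrable.of_bound hf.aestronglyMeasurable c (ae_of_all _ hb)
  rw [← integral_map (φ := fun ω => (X ω, Z ω)) (hX.prodMk hZ).aemeasurable
    hf.aestronglyMeasurable, h.map_prod_eq_prod_map_map hX.aemeasurable hZ.aemeasurable,
    integral_prod _ hint, integral_map hX.aemeasurable
      hf.stronglyMeasurable.integral_prod_right'.aestronglyMeasurable]
  congr 1
  ext ω
  exact integral_map hZ.aemeasurable (hf.comp measurable_prodMk_left).aestronglyMeasurable

/-- The Laplace transform of the interference at the near user. The near user is independent of the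
interferers, and the transform at a fixed point does not depend on the point. -/
theorem laplaceInterference_eq [IsProbabilityMeasure μ]
    (hnet : IsNetwork p μ user near g Y G ϑ) {s : ℝ} (hs : 0 ≤ s) :
    laplaceInterference p user near Y G ϑ μ s = Real.exp (-interferenceExponent p s) := by
  have hf : Measurable fun z : Plane × (ℕ → Plane) × (ℕ → (Link → ℝ) × ℝ) =>
      Real.exp (-(s * (interferenceAt p z.1 z.2.1 z.2.2).toReal)) :=
    Real.measurable_exp.comp ((measurable_interferenceAt p).ennreal_toReal.const_mul s).neg
  have h := integral_comp_prod_of_indepFun (measurable_near_user hnet)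
    (measurable_interferers hnet) (indepFun_near_user_interferers hnet) hf (c := 1) fun z => by
      rw [Real.abs_exp, Real.exp_le_one_iff, neg_nonpos]
      exact mul_nonneg hs ENNReal.toReal_nonneg
  refine h.trans ?_
  simp only [integral_exp_interferenceAt hnet hs]
  simp

/-- For the near user at `x`, `Theta` is the mean over the interferers of the approximation of the
tail of the Gamma law. -/
theorem Theta_eq_integral [IsProbabilityMeasure μ] (hnet : IsNetwork p μ user near g Y G ϑ)
    {τ β : ℝ} (hτ : 0 ≤ τ) (hβ : 0 ≤ β) (x : Plane) :
    Theta p (laplaceInterference p user near Y G ϑ μ) (p.link ‖x‖) ‖x‖ τ β =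
      ∫ ω, (1 - (1 - Real.exp (-(psi (p.N (p.link ‖x‖)) *
        fadingThreshold p τ β x (interferers Y G ϑ ω)))) ^ p.N (p.link ‖x‖)) ∂μ := by
  set κ := p.link ‖x‖ with hκ
  have hIm : Measurable fun ω =>
      interferenceAt p x (interferers Y G ϑ ω).1 (interferers Y G ϑ ω).2 := by
    have := (measurable_interferenceAt p).comp
      ((measurable_const (a := x)).prodMk (measurable_interferers hnet))
    exact this
  have hterm : ∀ n : ℕ, ∀ ω, Real.exp (-(psi (p.N κ) *
      fadingThreshold p τ β x (interferers Y G ϑ ω))) ^ n =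
      Real.exp (-(n * psi (p.N κ) * τ * ‖x‖ ^ p.expo κ * p.noise / (β * p.M * p.C κ))) *
        Real.exp (-(n * psi (p.N κ) * τ * ‖x‖ ^ p.expo κ / (β * p.M * p.C κ) *
          (interferenceAt p x (interferers Y G ϑ ω).1 (interferers Y G ϑ ω).2).toReal)) := by
    intro n ω
    rw [← Real.exp_nat_mul, ← Real.exp_add, fadingThreshold, ← hκ]
    congr 1
    ring
  simp only [one_sub_one_sub_pow, hterm]
  rw [integral_finsetSum, Theta]
  · refine Finset.sum_congr rfl fun n _ => ?_
    have h0 := theta_arg_nonneg p hτ hβ κ n (norm_nonneg x)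
    simp only [← mul_assoc]
    rw [integral_const_mul, integral_exp_interferenceAt hnet h0, laplaceInterference_eq hnet h0]
  · intro n _
    have h0 := theta_arg_nonneg p hτ hβ κ n (norm_nonneg x)
    refine ((Integrable.of_bound (C := 1) ?_ ?_).const_mul _).const_mul _
    · exact (Real.measurable_exp.comp (hIm.ennreal_toReal.const_mul _).neg).aestronglyMeasurable
    · refine ae_of_all _ fun ω => ?_
      rw [Real.norm_eq_abs, Real.abs_exp, Real.exp_le_one_iff, neg_nonpos]
      exact mul_nonneg h0 ENNReal.toReal_nonneg

end Network

/-! ### The coverage probability and its approximation -/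

/-- The coverage event, off the null sets where the near user is at the origin or the interference
is infinite. -/
theorem coverage_iff {p : Params} {Ω : Type*} {user : Fin (2 * p.K) → Ω → Plane}
    {near : Ω → Fin (2 * p.K)} {g : Link → Ω → ℝ} {Y : ℕ → Ω → Plane} {G : ℕ → Link → Ω → ℝ}
    {ϑ : ℕ → Ω → ℝ} {aj ak τj τk : ℝ} (hak : 0 < ak) (hτj : 0 < τj) (hτk : 0 < τk)
    (hregime : ak * τj * (1 + 1 / τk) < aj) {ω : Ω} (hpos : 0 < ‖user (near ω) ω‖)
    (hfin : interference p user near Y G ϑ ω ≠ ∞) :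
    (ENNReal.ofReal τj < sinrSIC p user near g Y G ϑ aj ak ω ∧
      ENNReal.ofReal τk < sinrNear p user near g Y G ϑ ak ω) ↔
      fadingThreshold p τk ak (user (near ω) ω) (interferers Y G ϑ ω) <
        g (p.link ‖user (near ω) ω‖) ω ^ 2 := by
  set r := ‖user (near ω) ω‖ with hr
  set S := signalPower p user near g ω with hS
  set i := (interference p user near Y G ϑ ω).toReal with hi
  have hI : interference p user near Y G ϑ ω = ENNReal.ofReal i := (ENNReal.ofReal_toReal hfin).symm
  have hi0 : 0 ≤ i := ENNReal.toReal_nonneg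
  have hn := p.noise_pos
  have hS0 : 0 ≤ S := mul_nonneg (by positivity) (pathLoss_nonneg p hpos.le)
  have haj : 0 < aj := lt_of_le_of_lt (by positivity) hregime
  have hnear : ENNReal.ofReal τk < sinrNear p user near g Y G ϑ ak ω ↔
      τk * (i + p.noise) < ak * S := by
    rw [sinrNear, hI, ← ENNReal.ofReal_add hi0 hn.le, ← ENNReal.ofReal_div_of_pos (by positivity),
      ENNReal.ofReal_lt_ofReal_iff_of_nonneg hτk.le, lt_div_iff₀ (by positivity)]
  have hsic : ENNReal.ofReal τj < sinrSIC p user near g Y G ϑ aj ak ω ↔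
      τj * (ak * S + (i + p.noise)) < aj * S := by
    rw [sinrSIC, hI, ← ENNReal.ofReal_add (by positivity) hi0,
      ← ENNReal.ofReal_add (by positivity) hn.le, ← ENNReal.ofReal_div_of_pos (by positivity),
      ENNReal.ofReal_lt_ofReal_iff_of_nonneg hτj.le, lt_div_iff₀ (by positivity), add_assoc]
  rw [hnear, hsic, and_iff_right_of_imp
    (sic_of_near hτj hτk hak (by positivity) hregime)]
  have hM : (0 : ℝ) < p.M := by exact_mod_cast p.M_pos
  have hC := p.C_pos (p.link r)
  have hpow : 0 < r ^ p.expo (p.link r) := Real.rpow_pos_of_pos hpos _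
  have hthr : fadingThreshold p τk ak (user (near ω) ω) (interferers Y G ϑ ω) =
      τk * r ^ p.expo (p.link r) * (i + p.noise) / (ak * p.M * p.C (p.link r)) := rfl
  have hSr : ak * S = g (p.link r) ω ^ 2 * (ak * p.M * p.C (p.link r)) / r ^ p.expo (p.link r) := by
    rw [hS, signalPower, Params.pathLoss, ← hr, Real.rpow_neg hpos.le]
    field_simp
  rw [hthr, hSr, lt_div_iff₀ hpow, div_lt_iff₀ (by positivity)]
  constructor <;> intro h <;> linarith

section Network

variable {p : Params} {Ω : Type*} [MeasurableSpace Ω] {μ : Measure Ω}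
  {user : Fin (2 * p.K) → Ω → Plane} {near : Ω → Fin (2 * p.K)} {g : Link → Ω → ℝ}
  {Y : ℕ → Ω → Plane} {G : ℕ → Link → Ω → ℝ} {ϑ : ℕ → Ω → ℝ}

theorem ae_norm_near_user_pos [IsProbabilityMeasure μ] (hnet : IsNetwork p μ user near g Y G ϑ) :
    ∀ᵐ ω ∂μ, 0 < ‖user (near ω) ω‖ := by
  have hm : Measurable fun ω => ‖user (near ω) ω‖ := (measurable_near_user hnet).norm
  have h : ∀ᵐ r ∂μ.map (fun ω => ‖user (near ω) ω‖), 0 < r := by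
    rw [map_norm_near_user hnet]
    exact (withDensity_absolutelyContinuous _ _).ae_le (self_mem_ae_restrict measurableSet_Ioi)
  exact ae_of_ae_map hm.aemeasurable h

/-- The coverage probability is the mean of the tail of the Gamma law at the fading threshold. -/
theorem coverageNear_eq_integral [IsProbabilityMeasure μ] (hnet : IsNetwork p μ user near g Y G ϑ)
    {aj ak τj τk : ℝ} (hak : 0 < ak) (hτj : 0 < τj) (hτk : 0 < τk)
    (hregime : ak * τj * (1 + 1 / τk) < aj) :
    coverageNear p user near g Y G ϑ μ aj ak τj τk =
      ∫ ω, (1 - cdf (gammaMeasure (p.N (p.link ‖user (near ω) ω‖)) (p.N (p.link ‖user (near ω) ω‖)))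
        (fadingThreshold p τk ak (user (near ω) ω) (interferers Y G ϑ ω))) ∂μ := by
  have hX := measurable_fadingThreshold p τk ak
  have hξ := measurable_near_user hnet
  have hW := measurable_interferers hnet
  have hg : Measurable fun ω => (fun κ => g κ ω : Link → ℝ) :=
    measurable_pi_lambda _ hnet.measurable_g
  -- the set of positions, fading amplitudes and interferers that give coverage
  set A : Set (Plane × (Link → ℝ) × ((ℕ → Plane) × (ℕ → (Link → ℝ) × ℝ))) :=
    {z | fadingThreshold p τk ak z.1 z.2.2 < z.2.1 (p.link ‖z.1‖) ^ 2} with hA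
  have hAm : MeasurableSet A := by
    have h1 : Measurable fun z : Plane × (Link → ℝ) × ((ℕ → Plane) × (ℕ → (Link → ℝ) × ℝ)) =>
        z.2.1 (p.link ‖z.1‖) :=
      measurable_link_rec p (r := fun z : Plane × (Link → ℝ) ×
        ((ℕ → Plane) × (ℕ → (Link → ℝ) × ℝ)) => ‖z.1‖) (by fun_prop) (f := fun κ z => z.2.1 κ)
        fun κ => by fun_prop
    have h2 := hX.comp (by fun_prop : Measurable fun z : Plane × (Link → ℝ) ×
      ((ℕ → Plane) × (ℕ → (Link → ℝ) × ℝ)) => (z.1, z.2.2))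
    exact measurableSet_lt h2 (h1.pow_const 2)
  set f : Plane × (Link → ℝ) × ((ℕ → Plane) × (ℕ → (Link → ℝ) × ℝ)) → ℝ≥0∞ :=
    A.indicator fun _ => 1 with hf
  have hfm : Measurable f := measurable_const.indicator hAm
  set q : Plane × ((ℕ → Plane) × (ℕ → (Link → ℝ) × ℝ)) → ℝ := fun z =>
    1 - cdf (gammaMeasure (p.N (p.link ‖z.1‖)) (p.N (p.link ‖z.1‖)))
      (fadingThreshold p τk ak z.1 z.2) with hq
  have hqm : Measurable q := by
    refine measurable_const.sub (measurable_link_rec p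
      (r := fun z : Plane × ((ℕ → Plane) × (ℕ → (Link → ℝ) × ℝ)) => ‖z.1‖) (by fun_prop)
      (f := fun κ z => cdf (gammaMeasure (p.N κ) (p.N κ)) (fadingThreshold p τk ak z.1 z.2))
      fun κ => ?_)
    exact (monotone_cdf _).measurable.comp hX
  have hq0 : ∀ z, 0 ≤ q z := fun z => sub_nonneg.2 (cdf_le_one _ _)
  have hmeas : μ {ω | ENNReal.ofReal τj < sinrSIC p user near g Y G ϑ aj ak ω ∧
      ENNReal.ofReal τk < sinrNear p user near g Y G ϑ ak ω} =
      ∫⁻ ω, ENNReal.ofReal (q (user (near ω) ω, interferers Y G ϑ ω)) ∂μ := by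
    have hset : {ω | ENNReal.ofReal τj < sinrSIC p user near g Y G ϑ aj ak ω ∧
        ENNReal.ofReal τk < sinrNear p user near g Y G ϑ ak ω} =ᵐ[μ]
        (fun ω => (user (near ω) ω, (fun κ => g κ ω : Link → ℝ), interferers Y G ϑ ω)) ⁻¹' A := by
      filter_upwards [ae_norm_near_user_pos hnet, ae_interference_ne_top hnet] with ω h1 h2
      exact propext (coverage_iff hak hτj hτk hregime h1 h2)
    have hZ : Measurable fun ω =>
        (user (near ω) ω, (fun κ => g κ ω : Link → ℝ), interferers Y G ϑ ω) :=
      hξ.prodMk (hg.prodMk hW)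
    have hone : ∫⁻ ω, f (user (near ω) ω, (fun κ => g κ ω : Link → ℝ), interferers Y G ϑ ω) ∂μ =
        μ ((fun ω => (user (near ω) ω, (fun κ => g κ ω : Link → ℝ), interferers Y G ϑ ω)) ⁻¹' A) :=
      lintegral_indicator_one (hZ hAm)
    rw [measure_congr hset, ← hone,
      lintegral_comp_prod_of_indepFun hξ (hg.prodMk hW) (indepFun_near_user hnet) hfm,
      lintegral_comp_prod_of_indepFun hξ hW (indepFun_near_user_interferers hnet)
        (f := fun z => ENNReal.ofReal (q z)) hqm.ennreal_ofReal]
    refine lintegral_congr fun ω => ?_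
    set x := user (near ω) ω
    have hfx : Measurable fun z : ((ℕ → Plane) × (ℕ → (Link → ℝ) × ℝ)) × (Link → ℝ) =>
        f (x, z.2, z.1) := hfm.comp (by fun_prop)
    refine (lintegral_comp_prod_of_indepFun hW hg hnet.indep_g_rest.symm hfx).trans ?_
    refine lintegral_congr fun ω' => ?_
    set w := interferers Y G ϑ ω'
    have hS : MeasurableSet {a : ℝ | fadingThreshold p τk ak x w < a ^ 2} :=
      measurableSet_lt measurable_const (by fun_prop)
    have hgm := hnet.measurable_g (p.link ‖x‖)
    have h1 : ∫⁻ ω'', f (x, (fun κ => g κ ω'' : Link → ℝ), w) ∂μ =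
        μ (g (p.link ‖x‖) ⁻¹' {a : ℝ | fadingThreshold p τk ak x w < a ^ 2}) :=
      lintegral_indicator_one (hgm hS)
    refine h1.trans ?_
    rw [← Measure.map_apply hgm hS, (hnet.hasLaw_g _).map_eq, nakagamiMeasure_sq_gt (p.N_pos _)
      (fadingThreshold_nonneg p hτk.le hak.le x w)]
  have hqm' : Measurable fun ω => q (user (near ω) ω, interferers Y G ϑ ω) :=
    hqm.comp (hξ.prodMk hW)
  rw [coverageNear, measureReal_def, hmeas]
  exact (integral_eq_lintegral_of_nonneg_ae (ae_of_all _ fun ω => hq0 _)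
    hqm'.aestronglyMeasurable).symm

theorem abs_laplaceInterference_le [IsProbabilityMeasure μ]
    (hnet : IsNetwork p μ user near g Y G ϑ) {s : ℝ} (hs : 0 ≤ s) :
    |laplaceInterference p user near Y G ϑ μ s| ≤ 1 := by
  rw [laplaceInterference_eq hnet hs, Real.abs_exp]
  exact exp_interferenceExponent_le_one p hs

theorem continuousOn_laplaceInterference [IsProbabilityMeasure μ]
    (hnet : IsNetwork p μ user near g Y G ϑ) :
    ContinuousOn (laplaceInterference p user near Y G ϑ μ) (Ici 0) :=
  ((continuousOn_interferenceExponent p).neg.rexp).congr fun _ hs => laplaceInterference_eq hnet hs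

theorem one_sub_exp_pow_mem_Icc {N : ℕ} {t : ℝ} (ht : 0 ≤ t) :
    (1 - Real.exp (-t)) ^ N ∈ Icc (0 : ℝ) 1 := by
  have h1 : Real.exp (-t) ≤ 1 := Real.exp_le_one_iff.2 (by linarith)
  have h2 := Real.exp_pos (-t)
  exact ⟨pow_nonneg (by linarith) _, pow_le_one₀ (by linarith) (by linarith)⟩

/-- The analytical expression is the mean of the approximate tail of the Gamma law at the fading
threshold. -/
theorem coverageFormula_eq_integral_threshold [IsProbabilityMeasure μ]
    (hnet : IsNetwork p μ user near g Y G ϑ) {τ β : ℝ} (hτ : 0 ≤ τ) (hβ : 0 ≤ β) :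
    coverageFormula p (laplaceInterference p user near Y G ϑ μ) τ β =
      ∫ ω, (1 - (1 - Real.exp (-(psi (p.N (p.link ‖user (near ω) ω‖)) *
        fadingThreshold p τ β (user (near ω) ω) (interferers Y G ϑ ω)))) ^
          p.N (p.link ‖user (near ω) ω‖)) ∂μ := by
  have hX := measurable_fadingThreshold p τ β
  set f : Plane × ((ℕ → Plane) × (ℕ → (Link → ℝ) × ℝ)) → ℝ := fun z =>
    1 - (1 - Real.exp (-(psi (p.N (p.link ‖z.1‖)) * fadingThreshold p τ β z.1 z.2))) ^
      p.N (p.link ‖z.1‖) with hf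
  have hfm : Measurable f := by
    refine measurable_link_rec p
      (r := fun z : Plane × ((ℕ → Plane) × (ℕ → (Link → ℝ) × ℝ)) => ‖z.1‖) (by fun_prop)
      (f := fun κ z => 1 - (1 - Real.exp (-(psi (p.N κ) * fadingThreshold p τ β z.1 z.2))) ^ p.N κ)
      fun κ => by fun_prop
  have hb : ∀ z, |f z| ≤ 1 := by
    intro z
    have := one_sub_exp_pow_mem_Icc (N := p.N (p.link ‖z.1‖)) (mul_nonneg
      (psi_pos (p.N_pos (p.link ‖z.1‖))).le (fadingThreshold_nonneg p hτ hβ z.1 z.2))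
    rw [abs_le]
    constructor <;> simp only [f] <;> linarith [this.1, this.2]
  have hc := continuousOn_laplaceInterference hnet
  have hΘ : AEStronglyMeasurable
      (fun r => Theta p (laplaceInterference p user near Y G ϑ μ) (p.link r) r τ β)
      (μ.map fun ω => ‖user (near ω) ω‖) := by
    rw [map_norm_near_user hnet]
    refine AEStronglyMeasurable.mono_ac (withDensity_absolutelyContinuous _ _) ?_
    rw [← Ioc_union_Ioi_eq_Ioi p.RL_pos.le]
    have h1 := fun κ => (continuousOn_Theta p hc hτ hβ κ).aestronglyMeasurable (μ := volume)
      measurableSet_Ici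
    refine aestronglyMeasurable_union_iff.2 ⟨?_, ?_⟩
    · refine ((h1 Link.los).mono_set (Ioc_subset_Icc_self.trans Icc_subset_Ici_self)).congr ?_
      filter_upwards [self_mem_ae_restrict measurableSet_Ioc] with r hr
      rw [link_of_le p hr.2]
    · refine ((h1 Link.nlos).mono_set (Ioi_subset_Ici p.RL_pos.le)).congr ?_
      filter_upwards [self_mem_ae_restrict measurableSet_Ioi] with r hr
      rw [link_of_lt p hr]
  rw [coverageFormula_eq_integral p hc (fun s hs => abs_laplaceInterference_le hnet hs) hτ hβ,
    ← map_norm_near_user hnet, integral_map (measurable_near_user hnet).norm.aemeasurable hΘ]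
  simp only [Theta_eq_integral hnet hτ hβ]
  exact (integral_comp_prod_of_indepFun (measurable_near_user hnet)
    (measurable_interferers hnet) (indepFun_near_user_interferers hnet) hfm hb).symm

/-- The error of the analytical expression is the mean of the error of the approximation of the
Gamma law. -/
theorem coverageFormula_sub_coverageNear [IsProbabilityMeasure μ]
    (hnet : IsNetwork p μ user near g Y G ϑ) {aj ak τj τk : ℝ} (hak : 0 < ak) (hτj : 0 < τj)
    (hτk : 0 < τk) (hregime : ak * τj * (1 + 1 / τk) < aj) :
    Integrable (fun ω => gammaError (p.N (p.link ‖user (near ω) ω‖))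
        (fadingThreshold p τk ak (user (near ω) ω) (interferers Y G ϑ ω))) μ ∧
    coverageFormula p (laplaceInterference p user near Y G ϑ μ) τk ak -
      coverageNear p user near g Y G ϑ μ aj ak τj τk =
      ∫ ω, gammaError (p.N (p.link ‖user (near ω) ω‖))
        (fadingThreshold p τk ak (user (near ω) ω) (interferers Y G ϑ ω)) ∂μ := by
  have hX := (measurable_fadingThreshold p τk ak).comp
    ((measurable_near_user hnet).prodMk (measurable_interferers hnet))
  have hr := (measurable_near_user hnet).norm
  have i1 : Integrable (fun ω => 1 - (1 - Real.exp (-(psi (p.N (p.link ‖user (near ω) ω‖)) *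
        fadingThreshold p τk ak (user (near ω) ω) (interferers Y G ϑ ω)))) ^
          p.N (p.link ‖user (near ω) ω‖)) μ := by
    refine Integrable.of_bound (C := 1) (Measurable.aestronglyMeasurable ?_)
      (ae_of_all _ fun ω => ?_)
    · exact measurable_link_rec p hr (f := fun κ ω => 1 - (1 - Real.exp (-(psi (p.N κ) *
        fadingThreshold p τk ak (user (near ω) ω) (interferers Y G ϑ ω)))) ^ p.N κ)
        fun κ => ((Real.measurable_exp.comp (hX.const_mul _).neg).const_sub 1).pow_const _
          |>.const_sub 1
    · have := one_sub_exp_pow_mem_Icc (N := p.N (p.link ‖user (near ω) ω‖)) (mul_nonneg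
        (psi_pos (p.N_pos (p.link ‖user (near ω) ω‖))).le
        (fadingThreshold_nonneg p hτk.le hak.le (user (near ω) ω) (interferers Y G ϑ ω)))
      rw [Real.norm_eq_abs, abs_le]
      constructor <;> linarith [this.1, this.2]
  have i2 : Integrable (fun ω => 1 - cdf (gammaMeasure (p.N (p.link ‖user (near ω) ω‖))
      (p.N (p.link ‖user (near ω) ω‖)))
        (fadingThreshold p τk ak (user (near ω) ω) (interferers Y G ϑ ω))) μ := by
    refine Integrable.of_bound (C := 1) (Measurable.aestronglyMeasurable ?_)
      (ae_of_all _ fun ω => ?_)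
    · exact measurable_link_rec p hr (f := fun κ ω => 1 - cdf (gammaMeasure (p.N κ) (p.N κ))
        (fadingThreshold p τk ak (user (near ω) ω) (interferers Y G ϑ ω)))
        fun κ => ((monotone_cdf _).measurable.comp hX).const_sub 1
    · rw [Real.norm_eq_abs, abs_le]
      constructor <;> linarith [cdf_nonneg (gammaMeasure (p.N (p.link ‖user (near ω) ω‖))
        (p.N (p.link ‖user (near ω) ω‖)))
        (fadingThreshold p τk ak (user (near ω) ω) (interferers Y G ϑ ω)),
        cdf_le_one (gammaMeasure (p.N (p.link ‖user (near ω) ω‖))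
        (p.N (p.link ‖user (near ω) ω‖)))
        (fadingThreshold p τk ak (user (near ω) ω) (interferers Y G ϑ ω))]
  have he : ∀ ω, gammaError (p.N (p.link ‖user (near ω) ω‖))
      (fadingThreshold p τk ak (user (near ω) ω) (interferers Y G ϑ ω)) =
      (1 - (1 - Real.exp (-(psi (p.N (p.link ‖user (near ω) ω‖)) *
        fadingThreshold p τk ak (user (near ω) ω) (interferers Y G ϑ ω)))) ^
          p.N (p.link ‖user (near ω) ω‖)) -
      (1 - cdf (gammaMeasure (p.N (p.link ‖user (near ω) ω‖)) (p.N (p.link ‖user (near ω) ω‖)))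
        (fadingThreshold p τk ak (user (near ω) ω) (interferers Y G ϑ ω))) := by
    intro ω
    rw [gammaError]
    ring
  simp only [he]
  refine ⟨i1.sub i2, ?_⟩
  rw [integral_sub i1 i2, coverageFormula_eq_integral_threshold hnet hτk.le hak.le,
    coverageNear_eq_integral hnet hak hτj hτk hregime]

end Network

end MmWaveNOMA

open MmWaveNOMA in
theorem theorem1 (p : Params) {Ω : Type*} [MeasurableSpace Ω] (μ : Measure Ω)
    [IsProbabilityMeasure μ]
    (user : Fin (2 * p.K) → Ω → Plane) (near : Ω → Fin (2 * p.K)) (g : Link → Ω → ℝ)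
    (Y : ℕ → Ω → Plane) (G : ℕ → Link → Ω → ℝ) (ϑ : ℕ → Ω → ℝ)
    (hnet : IsNetwork p μ user near g Y G ϑ)
    (aj ak τj τk : ℝ) (hak : 0 < ak) (hτj : 0 < τj) (hτk : 0 < τk)
    (hregime : ak * τj * (1 + 1 / τk) < aj) :
    FormulaIntegrable p (laplaceInterference p user near Y G ϑ μ) τk ak ∧
      (∀ n : ℕ, 1 ≤ n → FormulaIntegrable p (laplaceClosed p n) τk ak) ∧
      Tendsto (fun n : ℕ => coverageFormula p (laplaceClosed p n) τk ak) atTop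
        (𝓝 (coverageFormula p (laplaceInterference p user near Y G ϑ μ) τk ak)) ∧
      coverageNear p user near g Y G ϑ μ aj ak τj τk ≤
        coverageFormula p (laplaceInterference p user near Y G ϑ μ) τk ak ∧
      ∀ ε : ℝ, (∀ κ : Link, ∀ x : ℝ, 0 ≤ x → gammaError (p.N κ) x ≤ ε) →
        coverageFormula p (laplaceInterference p user near Y G ϑ μ) τk ak -
          coverageNear p user near g Y G ϑ μ aj ak τj τk ≤ ε := by
  obtain ⟨hint, hdiff⟩ := coverageFormula_sub_coverageNear hnet hak hτj hτk hregime
  have habs : ∀ n s, 0 ≤ s → |laplaceClosed p n s| ≤ 1 := fun n s hs => by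
    rw [abs_of_pos (laplaceClosed_pos p n s)]
    exact laplaceClosed_le_one p n hs
  refine ⟨formulaIntegrable p (continuousOn_laplaceInterference hnet)
      (fun s hs => abs_laplaceInterference_le hnet hs) hτk.le hak.le,
    fun n _ => formulaIntegrable p (continuousOn_laplaceClosed p n) (habs n) hτk.le hak.le,
    tendsto_coverageFormula p (continuousOn_laplaceClosed p) habs (fun s hs => ?_) hτk.le hak.le,
    ?_, fun ε hε => ?_⟩
  · rw [laplaceInterference_eq hnet hs]
    exact tendsto_laplaceClosed p hs
  · rw [← sub_nonneg, hdiff]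
    exact integral_nonneg fun ω =>
      gammaError_nonneg (p.N_pos _) (fadingThreshold_nonneg p hτk.le hak.le _ _)
  · rw [hdiff]
    calc _ ≤ ∫ _, ε ∂μ := integral_mono hint (integrable_const ε) fun ω =>
          hε _ _ (fadingThreshold_nonneg p hτk.le hak.le _ _)
      _ = ε := by simp
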